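/- For $x\in\mathbb{R}^n$ let $x_{[1]}\ge\dots\ge x_{[n]}$ be the non-increasing rearrangement of $|x_1|,\dots,|x_n|$. Sums $\sum_{i=1}^{b}$ run over all $i\in\mathbb{N}$ with $1\le i\le b$ ($b$ need not be an integer), and $0^0=1$. Below, $C,C_1,C_2,\dots$ are positive universal constants (depending on none of $n,r,p,t$), which may differ from case to case. **Theorem.** Let $X$ be a random vector in $\mathbb{R}^n$, $n\ge 3$, with the standard normal distribution, and let $0\le r<\infty$, $1\le p<\infty$, $t>0$. In each of the following cases, with $R$, $S$ and $|\cdot|_\sharp$ as defined there, $$\mathbb{P}\{|X|_\sharp\le S\}\ge 1-Ce^{-t^2/2},\qquad\text{and for all }x\in\mathbb{R}^n:\quad |x|_\sharp\le S\ \Rightarrow\ \sum_{i=1}^n i^{-2r}x_{[i]}^{2(p-1)}\le R .$$ **Case I:** $p\ge 3/2$. Put $|x|_\sharp=\big(\sum_{i=1}^n i^{-2r}x_{[i]}^{2(p-1)}\big)^{1/(2(p-1))}$, which is a norm, and $R=S^{2(p-1)}=A+Bt^{2(p-1)}$, where $$A=\frac{C_1^pp^pn^{1-2r}(\ln n)^p}{[p+(1-2r)\ln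 n]^p}\ \text{ if } r\le\tfrac12,\qquad A=\frac{C_1^p(\ln n)^p}{1+(2r-1)\ln n}+C_1^p(\ln n)^{p-1}\ \text{ if } r>\tfrac12,$$ $$B=C_1\Big[1+\Big(\frac{\ln n}{1+|2-2r-p|\ln n}\Big)^{2-p}\big(1+n^{2-2r-p}\big)\Big]\ \text{ if } p<2,\qquad B=C_1^p\ \text{ if } p\ge 2 .$$ **Case II:** $1\le p<3/2$. Put $\Sigma=\sum_{i=1}^{n/e}i^{-2r}\big(\ln\frac ni+\frac{t^2}{i}\big)^{p-1}$ and $|x|_\sharp=\sum_{i=1}^{n/e}i^{-2r}x_{[i]}\big(\ln\frac ni+\frac{t^2}{i}\big)^{-(3-2p)/2}$. Then for all $x\in\mathbb{R}^n$ $$\sum_{i=1}^n i^{-2r}x_{[i]}^{2(p-1)}\le C_1\Sigma^{3-2p}|x|_\sharp^{2(p-1)}.$$ Here $S=C_2\Sigma$ and $R=C_3\Sigma$, and both $S$ and $R$ are at most $$\frac{C_4n^{1-2r}(\ln n)^p}{[1+(1-2r)\ln n]^p}1_{\{r\le 1/2\}}+C_4\Big(\frac{(\ln n)^p}{1+(2r-1)\ln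 n}+(\ln n)^{p-1}\Big)1_{\{r>1/2\}}+C_4\Big(1+\frac{1+n^{2-2r-p}}{1+|2-2r-p|\ln n}\ln n\Big)t^{2(p-1)} .$$ If moreover $p\ge 3/2-2r$, then $|\cdot|_\sharp$ is a norm. **Case III:** $p<3/2-2r$ (so $r<1/4$ and $p<3/2$). Put $|x|_\sharp=\sum_{i=1}^n i^{-2r}x_{[i]}$, which is a norm. Then for all $x\in\mathbb{R}^n$ $$\sum_{i=1}^n i^{-2r}x_{[i]}^{2(p-1)}\le C_1n^{(1-2r)(3-2p)}|x|_\sharp^{2(p-1)},$$ and $$S=C_2n^{1-2r}+C_2n^{\frac{1-4r}{2}}\Big(\frac{\ln n}{1+(1-4r)\ln n}\Big)^{1/2}t,$$ $$R=C_1n^{(1-2r)(3-2p)}S^{2(p-1)}\le C_3n^{1-2r}+C_3n^{2-2r-p}\Big(\frac{\ln n}{1+(1-4r)\ln n}\Big)^{p-1}t^{2(p-1)} .$$ **Case IV:** $r\in(1/4,1/2]$ and $p=2(1-r)$ (so $1\le p<3/2$). *IVa:* $(1-2r)\ln n\ge e$ (so $p>1$). Put $$\beta_i=\frac{(1-2r)^p\ln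 n}{n^{1-2r}}\,i^{-2r}\Big(\ln\frac ni\Big)^{p-1}+i^{-1},\qquad |x|_\sharp=\sum_{i=1}^{n/e}\beta_i^{\frac{-(3-2p)}{2(p-1)}}i^{\frac{-r}{p-1}}x_{[i]} .$$ The coefficients in this sum are non-increasing in $i$ for $1\le i\le n/e$, and $|\cdot|_\sharp$ is a norm. For all $x\in\mathbb{R}^n$, $\sum_{i=1}^n i^{-2r}x_{[i]}^{2(p-1)}\le C_1(\ln n)^{3-2p}|x|_\sharp^{2(p-1)}$. Here $$S=C_2^{\frac1{p-1}}(1-2r)^{\frac{-p}{2(p-1)}}(\ln n)^{\frac{-(3-2p)}{2(p-1)}}n^{1/2}+C_2^{\frac1{p-1}}(\ln n)^{1/2}t,$$ $$R=C_1(\ln n)^{3-2p}S^{2(p-1)}\le C_3(1-2r)^{-1}n^{1-2r}+C_3(\ln n)^{2-p}t^{2(p-1)} .$$ *IVb:* $(1-2r)\ln n<e$. Let $|\cdot|_\sharp$ be the Euclidean norm $|\cdot|$. For all $x\in\mathbb{R}^n$, $\sum_{i=1}^n i^{-2r}x_{[i]}^{2(p-1)}\le C_1(\ln n)|x|^{2(p-1)}$.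 Here $S=C_2n^{1/2}+t$ and $R=C_1(\ln n)S^{2(p-1)}\le C_3(\ln n)\max\{1,t\}^{2(p-1)}$. So, whenever $|\cdot|_\sharp$ is a norm, a sublevel set of the (in general non-convex) functional $x\mapsto\sum_i i^{-2r}x_{[i]}^{2(p-1)}$ contains the convex set $\{|x|_\sharp\le S\}$ of large Gaussian measure. -/

import Mathlib

open MeasureTheory ProbabilityTheory

universe u

noncomputable section

namespace Lorentz

/-- `ℝⁿ` with the standard Euclidean norm. -/
abbrev E (n : ℕ) : Type := EuclideanSpace ℝ (Fin n)

/-- `ord x i = x_[i]`, the `i`-th entry, `1 ≤ i ≤ n`, of the non-increasing rearrangement of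
`|x_1|, …, |x_n|` (indices start at `1`; the value is `0` outside `1 ≤ i ≤ n`). -/
def ord {n : ℕ} (x : E n) (i : ℕ) : ℝ :=
  if h : 1 ≤ i ∧ i ≤ n then |x (Tuple.sort (fun j : Fin n => -|x j|) ⟨i - 1, by omega⟩)| else 0

/-- The functional `∑_{i=1}^n i^{-2r} x_[i]^{2(p-1)}`, with the convention `0 ^ 0 = 1`. -/
def lorentzSum {n : ℕ} (r p : ℝ) (x : E n) : ℝ :=
  ∑ i ∈ Finset.Icc 1 n, (i : ℝ) ^ (-2 * r) * ord x i ^ (2 * (p - 1))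

/-- The indices `i ∈ ℕ` with `1 ≤ i ≤ n / e`. -/
def idx (n : ℕ) : Finset ℕ := Finset.Icc 1 ⌊(n : ℝ) / Real.exp 1⌋₊

/-- `N` is a norm on `ℝⁿ`: a seminorm that vanishes only at the origin. -/
def IsNorm {n : ℕ} (N : E n → ℝ) : Prop :=
  ∃ q : Seminorm ℝ (E n), (∀ x, q x = N x) ∧ ∀ x, q x = 0 → x = 0

/-- For every random vector `X` in `ℝⁿ` with the standard normal distribution,
`ℙ{N(X) ≤ S} ≥ 1 - C exp(-t² / 2)`. -/
def GaussianBound {n : ℕ} (C t : ℝ) (N : E n → ℝ) (S : ℝ) : Prop :=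
  ∀ (Ω : Type u) [MeasurableSpace Ω] (P : Measure Ω) [IsProbabilityMeasure P] (X : Ω → E n),
    HasLaw X (stdGaussian (E n)) P →
      1 - C * Real.exp (-t ^ 2 / 2) ≤ P.real {ω | N (X ω) ≤ S}

/-! Case I -/

def normI {n : ℕ} (r p : ℝ) (x : E n) : ℝ := lorentzSum r p x ^ (1 / (2 * (p - 1)))

def coefA (C : ℝ) (n : ℕ) (r p : ℝ) : ℝ :=
  if r ≤ 1 / 2 then
    C ^ p * p ^ p * (n : ℝ) ^ (1 - 2 * r) * Real.log n ^ p / (p + (1 - 2 * r) * Real.log n) ^ p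
  else
    C ^ p * Real.log n ^ p / (1 + (2 * r - 1) * Real.log n) + C ^ p * Real.log n ^ (p - 1)

def coefB (C : ℝ) (n : ℕ) (r p : ℝ) : ℝ :=
  if p < 2 then
    C * (1 + (Real.log n / (1 + |2 - 2 * r - p| * Real.log n)) ^ (2 - p)
      * (1 + (n : ℝ) ^ (2 - 2 * r - p)))
  else C ^ p

def levelI (C : ℝ) (n : ℕ) (r p t : ℝ) : ℝ := coefA C n r p + coefB C n r p * t ^ (2 * (p - 1))

/-! Case II -/

/-- `∑_{1 ≤ i ≤ n/e} i^{-2r} (ln (n/i) + t²/i)^{p-1}`. -/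
def sumII (n : ℕ) (r p t : ℝ) : ℝ :=
  ∑ i ∈ idx n, (i : ℝ) ^ (-2 * r) * (Real.log (n / i) + t ^ 2 / i) ^ (p - 1)

def normII {n : ℕ} (r p t : ℝ) (x : E n) : ℝ :=
  ∑ i ∈ idx n, (i : ℝ) ^ (-2 * r) * ord x i
    / (Real.log (n / i) + t ^ 2 / i) ^ ((3 - 2 * p) / 2)

def boundII (C : ℝ) (n : ℕ) (r p t : ℝ) : ℝ :=
  (if r ≤ 1 / 2 then
    C * (n : ℝ) ^ (1 - 2 * r) * Real.log n ^ p / (1 + (1 - 2 * r) * Real.log n) ^ p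
  else
    C * (Real.log n ^ p / (1 + (2 * r - 1) * Real.log n) + Real.log n ^ (p - 1)))
  + C * (1 + (1 + (n : ℝ) ^ (2 - 2 * r - p)) / (1 + |2 - 2 * r - p| * Real.log n) * Real.log n)
    * t ^ (2 * (p - 1))

/-! Case III -/

def normIII {n : ℕ} (r : ℝ) (x : E n) : ℝ := ∑ i ∈ Finset.Icc 1 n, (i : ℝ) ^ (-2 * r) * ord x i

def levelIII (C : ℝ) (n : ℕ) (r t : ℝ) : ℝ :=
  C * (n : ℝ) ^ (1 - 2 * r)
    + C * (n : ℝ) ^ ((1 - 4 * r) / 2)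
      * (Real.log n / (1 + (1 - 4 * r) * Real.log n)) ^ (1 / 2 : ℝ) * t

def boundIII (C : ℝ) (n : ℕ) (r p t : ℝ) : ℝ :=
  C * (n : ℝ) ^ (1 - 2 * r)
    + C * (n : ℝ) ^ (2 - 2 * r - p)
      * (Real.log n / (1 + (1 - 4 * r) * Real.log n)) ^ (p - 1) * t ^ (2 * (p - 1))

/-! Case IVa -/

def beta (n : ℕ) (r p : ℝ) (i : ℕ) : ℝ :=
  (1 - 2 * r) ^ p * Real.log n / (n : ℝ) ^ (1 - 2 * r)
    * (i : ℝ) ^ (-2 * r) * Real.log (n / i) ^ (p - 1) + (i : ℝ)⁻¹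

def coefIVa (n : ℕ) (r p : ℝ) (i : ℕ) : ℝ :=
  beta n r p i ^ (-(3 - 2 * p) / (2 * (p - 1))) * (i : ℝ) ^ (-r / (p - 1))

def normIVa {n : ℕ} (r p : ℝ) (x : E n) : ℝ := ∑ i ∈ idx n, coefIVa n r p i * ord x i

def levelIVa (C : ℝ) (n : ℕ) (r p t : ℝ) : ℝ :=
  C ^ (1 / (p - 1)) * (1 - 2 * r) ^ (-p / (2 * (p - 1)))
      * Real.log n ^ (-(3 - 2 * p) / (2 * (p - 1))) * (n : ℝ) ^ (1 / 2 : ℝ)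
    + C ^ (1 / (p - 1)) * Real.log n ^ (1 / 2 : ℝ) * t

end Lorentz

end

namespace Lorentz

/-! Elementary sums -/

/-! All cases except IVb rest on one Gaussian event, `goodSet`: for every nonempty set T of k
coordinates, the sum of x_j² over T is at most 8(k ln(en/k) + t²). Chernoff's bound for a chi-square
variable, with a union bound over the at most exp(k ln(en/k)) sets of size k, gives its complement
probability at most 4 exp(-t²/2) (`stdGaussian_goodSet_compl_le`). Everything after that is
deterministic.

On the event there are two kinds of control. Pointwise, x_[k]² ≤ 8(ln(en/k) + t²/k). In aggregate,
the parts of x_[i]² above 16 ln(en/i) have total at most 16t² (`sum_excess_le`). So x_[i]² splits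
into a logarithmic profile, which contributes `logSum` (bounded by `logSum_le_coefA`), and an excess
bounded in ℓ¹, whose weighted sums are handled by Hölder or Cauchy–Schwarz and power sums in i.
Quotients such as ln n / (1 + |η| ln n) are comparable to min(ln n, 1/|η|) and keep these bounds
uniform as η tends to 0.

A sum of c_i x_[i]^q with q ≥ 1 and non-increasing c is a maximum over permutations, so its q-th
root is a norm by Minkowski (`isNorm_rpow_sum`). This settles Case I, where q = 2(p-1) ≥ 1. When
2(p-1) < 1, the functional is dominated by a weighted ℓ¹ sum of order statistics: factoring i^{-2r}
= a_i^{2(p-1)} b_i^{3-2p}, Hölder bounds it by (∑ b_i)^{3-2p} (∑ a_i x_[i])^{2(p-1)}, up to a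
constant. In Case II, b_i is the size of the i-th summand on the event. In Case III, a_i = b_i =
i^{-2r}, which stays monotone when the weights of Case II might not. In Case IVa, at the critical
exponent, b_i = β_i adds a normalised profile and 1/i, so that both parts sum to order ln n. In Case
IVb, n^{1-2r} is bounded and the Euclidean norm, with its own sharper Chernoff bound, suffices. -/

lemma one_le_log {n : ℕ} (hn : 3 ≤ n) : 1 ≤ Real.log n := by
  rw [Real.le_log_iff_exp_le (by positivity)]
  have h3 : (3 : ℝ) ≤ n := by exact_mod_cast hn
  linarith [Real.exp_one_lt_d9]

lemma sum_inv_le (n : ℕ) : ∑ i ∈ Finset.Icc 1 n, (i : ℝ)⁻¹ ≤ 1 + Real.log n := by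
  have h := harmonic_le_one_add_log n
  rw [harmonic_eq_sum_Icc] at h
  push_cast at h
  exact h

/-- Bernoulli's inequality with exponent b ≤ 1 gives (n+1)^b - n^b ≥ b (n+1)^{b-1}, and the sum
telescopes. -/
lemma sum_rpow_sub_one_le {b : ℝ} (hb : 0 < b) (hb1 : b ≤ 1) (n : ℕ) :
    ∑ i ∈ Finset.Icc 1 n, (i : ℝ) ^ (b - 1) ≤ (n : ℝ) ^ b / b := by
  induction n with
  | zero => simp [Real.zero_rpow hb.ne']
  | succ n ih =>
    rw [Finset.sum_Icc_succ_top (by omega)]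
    have hy : (0 : ℝ) < ((n + 1 : ℕ) : ℝ) := by positivity
    have hs : (-1 : ℝ) ≤ -(1 / ((n + 1 : ℕ) : ℝ)) := by
      rw [neg_le_neg_iff, div_le_one hy]
      push_cast
      linarith [Nat.cast_nonneg (α := ℝ) n]
    have h1 := rpow_one_add_le_one_add_mul_self hs hb.le hb1
    have h2 : (n : ℝ) = ((n + 1 : ℕ) : ℝ) * (1 + -(1 / ((n + 1 : ℕ) : ℝ))) := by
      field_simp
      push_cast
      ring
    have h3 : (n : ℝ) ^ b ≤ ((n + 1 : ℕ) : ℝ) ^ b * (1 + b * -(1 / ((n + 1 : ℕ) : ℝ))) := by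
      conv_lhs => rw [h2]
      rw [Real.mul_rpow hy.le (by linarith)]
      gcongr
    rw [Real.rpow_sub_one hy.ne']
    calc _ ≤ (n : ℝ) ^ b / b + ((n + 1 : ℕ) : ℝ) ^ b / ((n + 1 : ℕ) : ℝ) := by gcongr
      _ ≤ (((n + 1 : ℕ) : ℝ) ^ b * (1 + b * -(1 / ((n + 1 : ℕ) : ℝ)))) / b
          + ((n + 1 : ℕ) : ℝ) ^ b / ((n + 1 : ℕ) : ℝ) := by gcongr
      _ = _ := by field_simp; ring

lemma sum_rpow_neg_le {b : ℝ} (hb : 0 < b) (n : ℕ) :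
    ∑ i ∈ Finset.Icc 1 n, (i : ℝ) ^ (-1 - b) ≤ 1 + 1 / b := by
  -- The bound by 1 plus the integral of u^{-1-b} over [1, n+1] is stronger and closes under
  -- induction.
  suffices h : ∀ n : ℕ, ∑ i ∈ Finset.Icc 1 (n + 1), (i : ℝ) ^ (-1 - b)
      ≤ 1 + (1 - ((n + 1 : ℕ) : ℝ) ^ (-b)) / b by
    rcases n with _ | n
    · simp; positivity
    · refine (h n).trans ?_
      gcongr
      linarith [Real.rpow_nonneg (Nat.cast_nonneg (α := ℝ) (n + 1)) (-b)]
  intro n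
  induction n with
  | zero => simp
  | succ n ih =>
    rw [Finset.sum_Icc_succ_top (by omega)]
    set x : ℝ := ((n + 1 : ℕ) : ℝ) with hx
    have hx0 : 0 < x := by positivity
    have hy : ((n + 1 + 1 : ℕ) : ℝ) = x + 1 := by rw [hx]; push_cast; ring
    rw [hy]
    have hkey : (x + 1) ^ (-b) * (1 + b / (x + 1)) ≤ x ^ (-b) := by
      have h1 : Real.log (x / (x + 1)) ≤ x / (x + 1) - 1 :=
        Real.log_le_sub_one_of_pos (by positivity)
      have h2 : x / (x + 1) - 1 = -(1 / (x + 1)) := by field_simp; ring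
      have h3 : x ^ (-b) = (x + 1) ^ (-b) * (x / (x + 1)) ^ (-b) := by
        rw [← Real.mul_rpow (by positivity) (by positivity)]
        congr 1
        field_simp
      rw [h3]
      gcongr
      rw [Real.rpow_def_of_pos (by positivity)]
      refine le_trans ?_ (Real.add_one_le_exp _)
      have h4 : b * (1 / (x + 1)) ≤ Real.log (x / (x + 1)) * -b := by nlinarith
      calc 1 + b / (x + 1) = b * (1 / (x + 1)) + 1 := by ring
        _ ≤ _ := by linarith
    have h5 : (x + 1) ^ (-1 - b) = (x + 1) ^ (-b) / (x + 1) := by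
      rw [← Real.rpow_sub_one (by positivity)]
      ring_nf
    rw [h5]
    calc _ ≤ 1 + (1 - x ^ (-b)) / b + (x + 1) ^ (-b) / (x + 1) := by gcongr
      _ ≤ 1 + (1 - (x + 1) ^ (-b) * (1 + b / (x + 1))) / b + (x + 1) ^ (-b) / (x + 1) := by
        gcongr
      _ = _ := by field_simp; ring

/-- If η ln n ≤ 1, compare with n^η times the harmonic sum; otherwise n^η/η is already of the right
order. The quotient covers both regimes without a singularity at η = 0. -/
lemma sum_rpow_le_of_nonneg {η : ℝ} (h0 : 0 ≤ η) (h1 : η ≤ 1) {n : ℕ} (hn : 3 ≤ n) :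
    ∑ i ∈ Finset.Icc 1 n, (i : ℝ) ^ (η - 1)
      ≤ 4 * (n : ℝ) ^ η * (Real.log n / (1 + η * Real.log n)) := by
  have hL := one_le_log hn
  set l := Real.log n
  have hn0 : (0 : ℝ) < n := by positivity
  rcases le_total (η * l) 1 with h | h
  · calc ∑ i ∈ Finset.Icc 1 n, (i : ℝ) ^ (η - 1)
        ≤ ∑ i ∈ Finset.Icc 1 n, (n : ℝ) ^ η * (i : ℝ)⁻¹ := by
          refine Finset.sum_le_sum fun i hi => ?_
          rw [Finset.mem_Icc] at hi
          have hi0 : (0 : ℝ) < i := by exact_mod_cast hi.1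
          rw [Real.rpow_sub_one hi0.ne', div_eq_mul_inv]
          gcongr
          exact_mod_cast hi.2
      _ ≤ (n : ℝ) ^ η * (1 + l) := by
          rw [← Finset.mul_sum]
          gcongr
          exact sum_inv_le n
      _ ≤ (n : ℝ) ^ η * (4 * (l / (1 + η * l))) := by
          gcongr
          rw [← mul_div_assoc, le_div_iff₀ (by positivity)]
          nlinarith
      _ = _ := by ring
  · have hη : 0 < η := by
      rcases h0.eq_or_lt with h' | h'
      · rw [← h'] at h; linarith
      · exact h'
    refine (sum_rpow_sub_one_le hη h1 n).trans ?_
    rw [div_eq_mul_inv, mul_comm (4 : ℝ), mul_assoc]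
    gcongr
    rw [inv_eq_one_div, ← mul_div_assoc, div_le_div_iff₀ hη (by positivity)]
    nlinarith

lemma sum_rpow_le_of_pos {b : ℝ} (h0 : 0 < b) {n : ℕ} (hn : 3 ≤ n) :
    ∑ i ∈ Finset.Icc 1 n, (i : ℝ) ^ (-1 - b)
      ≤ 1 + 2 * (Real.log n / (1 + b * Real.log n)) := by
  have hL := one_le_log hn
  rcases le_total (b * Real.log n) 1 with h | h
  · calc ∑ i ∈ Finset.Icc 1 n, (i : ℝ) ^ (-1 - b)
        ≤ ∑ i ∈ Finset.Icc 1 n, (i : ℝ)⁻¹ := by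
          refine Finset.sum_le_sum fun i hi => ?_
          rw [Finset.mem_Icc] at hi
          rw [← Real.rpow_neg_one]
          exact Real.rpow_le_rpow_of_exponent_le (by exact_mod_cast hi.1) (by linarith)
      _ ≤ 1 + Real.log n := sum_inv_le n
      _ ≤ _ := by
          gcongr
          rw [← mul_div_assoc, le_div_iff₀ (by positivity)]
          nlinarith
  · refine (sum_rpow_neg_le h0 n).trans ?_
    gcongr
    rw [← mul_div_assoc, div_le_div_iff₀ h0 (by positivity)]
    nlinarith

lemma sum_rpow_le {η : ℝ} (h1 : η ≤ 1) {n : ℕ} (hn : 3 ≤ n) :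
    ∑ i ∈ Finset.Icc 1 n, (i : ℝ) ^ (η - 1)
      ≤ 1 + 4 * (1 + (n : ℝ) ^ η) * (Real.log n / (1 + |η| * Real.log n)) := by
  have hL := one_le_log hn
  have hq : 0 ≤ Real.log n / (1 + |η| * Real.log n) := by positivity
  have hnη : 0 ≤ (n : ℝ) ^ η := by positivity
  rcases le_or_gt 0 η with h | h
  · refine (sum_rpow_le_of_nonneg h h1 hn).trans ?_
    rw [abs_of_nonneg h] at *
    nlinarith
  · have := sum_rpow_le_of_pos (b := -η) (by linarith) hn
    rw [abs_of_neg h] at *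
    rw [show η - 1 = -1 - -η by ring]
    nlinarith

/-! ### The logarithmic profile and its weighted sum -/

lemma one_le_one_add_log_div {n i : ℕ} (hi : 1 ≤ i) (hin : i ≤ n) :
    1 ≤ 1 + Real.log (n / i) := by
  have : (0 : ℝ) < i := by exact_mod_cast hi
  have h : 0 ≤ Real.log ((n : ℝ) / i) := by
    apply Real.log_nonneg
    rw [one_le_div this]
    exact_mod_cast hin
  linarith

lemma log_div_le_log {n i : ℕ} (hi : 1 ≤ i) (hin : i ≤ n) :
    Real.log ((n : ℝ) / i) ≤ Real.log n := by
  have h0 : (1 : ℝ) ≤ i := by exact_mod_cast hi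
  have h1 : (i : ℝ) ≤ n := by exact_mod_cast hin
  apply Real.log_le_log
  · apply div_pos <;> linarith
  · exact div_le_self (by linarith) h0

/-- `∑_{i ≤ n} i^{-2r} (ln (en/i))^{p-1}`. -/
noncomputable def logSum (n : ℕ) (r p : ℝ) : ℝ :=
  ∑ i ∈ Finset.Icc 1 n, (i : ℝ) ^ (-2 * r) * (1 + Real.log (n / i)) ^ (p - 1)

lemma logSum_le_of_small {n : ℕ} {r p : ℝ} (hn : 3 ≤ n) (hr : r ≤ 1 / 2) (hp : 1 ≤ p) :
    logSum n r p ≤ (n : ℝ) ^ (1 - 2 * r) * (2 * Real.log n) ^ p := by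
  have hL := one_le_log hn
  calc logSum n r p
      ≤ ∑ i ∈ Finset.Icc 1 n, (n : ℝ) ^ (1 - 2 * r) * (2 * Real.log n) ^ (p - 1) * (i : ℝ)⁻¹ := by
        refine Finset.sum_le_sum fun i hi => ?_
        rw [Finset.mem_Icc] at hi
        have hi0 : (0 : ℝ) < i := by exact_mod_cast hi.1
        have h1 := one_le_one_add_log_div hi.1 hi.2
        have h2 := log_div_le_log hi.1 hi.2
        rw [show -2 * r = (1 - 2 * r) - 1 by ring, Real.rpow_sub_one hi0.ne', div_eq_mul_inv]
        calc (i : ℝ) ^ (1 - 2 * r) * (i : ℝ)⁻¹ * (1 + Real.log (n / i)) ^ (p - 1)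
            ≤ (n : ℝ) ^ (1 - 2 * r) * (i : ℝ)⁻¹ * (2 * Real.log n) ^ (p - 1) := by
              have h3 : (i : ℝ) ^ (1 - 2 * r) ≤ (n : ℝ) ^ (1 - 2 * r) :=
                Real.rpow_le_rpow hi0.le (by exact_mod_cast hi.2) (by linarith)
              have h4 : (1 + Real.log (n / i)) ^ (p - 1) ≤ (2 * Real.log n) ^ (p - 1) :=
                Real.rpow_le_rpow (by linarith) (by linarith) (by linarith)
              gcongr
          _ = _ := by ring
    _ ≤ (n : ℝ) ^ (1 - 2 * r) * (2 * Real.log n) ^ (p - 1) * (2 * Real.log n) := by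
        rw [← Finset.mul_sum]
        gcongr
        linarith [sum_inv_le n]
    _ = _ := by
        rw [mul_assoc, ← Real.rpow_add_one (by positivity)]
        ring_nf

lemma rpow_le_exp {z q : ℝ} (hz : 0 ≤ z) (hq : 0 ≤ q) : z ^ q ≤ Real.exp (z * q) := by
  calc z ^ q ≤ Real.exp z ^ q := by
        gcongr
        linarith [Real.add_one_le_exp z]
    _ = _ := (Real.exp_mul z q).symm

/-- With a = 1 - 2r, the logarithmic factor is absorbed by half of the available power:
ln(en/i)^{p-1} ≤ 2 (2p/a)^{p-1} (n/i)^{a/2}. What remains is the sum of i^{a/2-1}. -/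
lemma logSum_le_of_pos {n : ℕ} {r p : ℝ} (hn : 3 ≤ n) (hr0 : 0 ≤ r) (hr : r < 1 / 2) (hp : 1 ≤ p) :
    logSum n r p ≤ (4 * p / (1 - 2 * r)) ^ p * (n : ℝ) ^ (1 - 2 * r) := by
  obtain ⟨a, ha⟩ : ∃ a, a = 1 - 2 * r := ⟨_, rfl⟩
  have ha0 : 0 < a := by linarith
  have hn0 : (0 : ℝ) < n := by positivity
  rw [← ha]
  calc logSum n r p
      ≤ ∑ i ∈ Finset.Icc 1 n, (2 * p / a) ^ (p - 1) * (2 * (n : ℝ) ^ (a / 2))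
          * (i : ℝ) ^ (a / 2 - 1) := by
        refine Finset.sum_le_sum fun i hi => ?_
        rw [Finset.mem_Icc] at hi
        have hi0 : (0 : ℝ) < i := by exact_mod_cast hi.1
        have h1 := one_le_one_add_log_div hi.1 hi.2
        have h2 : (1 + Real.log (n / i)) ^ (p - 1)
            ≤ (2 * p / a) ^ (p - 1) * (2 * (n : ℝ) ^ (a / 2) * (i : ℝ) ^ (-(a / 2))) := by
          -- The scale 2p/a makes the second factor z satisfy z(p-1) ≤ (a/2) ln(en/i), so z^{p-1} ≤
          -- e^{z(p-1)} costs only (n/i)^{a/2} and e^{1/2} ≤ 2.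
          have e1 : 1 + Real.log (n / i)
              = (2 * p / a) * (a * (1 + Real.log (n / i)) / (2 * p)) := by
            field_simp
          rw [e1, Real.mul_rpow (by positivity) (by positivity)]
          gcongr
          refine (rpow_le_exp (by positivity) (by linarith)).trans ?_
          have e2 : a * (1 + Real.log (n / i)) / (2 * p) * (p - 1)
              ≤ 1 / 2 + Real.log (n / i) * (a / 2) := by
            rw [div_mul_eq_mul_div, div_le_iff₀ (by positivity)]
            have : a ≤ 1 := by linarith
            nlinarith [mul_nonneg ha0.le (by linarith : 0 ≤ 1 + Real.log (n / i))]
          refine (Real.exp_le_exp.2 e2).trans ?_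
          rw [Real.exp_add, Real.exp_mul, Real.exp_log (by positivity),
            Real.div_rpow hn0.le hi0.le, Real.rpow_neg hi0.le, ← div_eq_mul_inv, mul_div_assoc]
          gcongr
          have : Real.exp (1 / 2) ^ 2 ≤ 2 ^ 2 := by
            rw [← Real.exp_nat_mul]
            norm_num
            linarith [Real.exp_one_lt_d9]
          exact (pow_le_pow_iff_left₀ (Real.exp_pos _).le (by norm_num) (by norm_num)).1 this
        calc (i : ℝ) ^ (-2 * r) * (1 + Real.log (n / i)) ^ (p - 1)
            ≤ (i : ℝ) ^ (-2 * r)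
              * ((2 * p / a) ^ (p - 1) * (2 * (n : ℝ) ^ (a / 2) * (i : ℝ) ^ (-(a / 2)))) := by
              gcongr
          _ = (2 * p / a) ^ (p - 1) * (2 * (n : ℝ) ^ (a / 2))
              * ((i : ℝ) ^ (-2 * r) * (i : ℝ) ^ (-(a / 2))) := by ring
          _ = _ := by
              rw [← Real.rpow_add hi0]
              congr 2
              rw [ha]; ring
    _ ≤ (2 * p / a) ^ (p - 1) * (2 * (n : ℝ) ^ (a / 2)) * ((n : ℝ) ^ (a / 2) / (a / 2)) := by
        rw [← Finset.mul_sum]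
        gcongr
        exact sum_rpow_sub_one_le (by linarith) (by linarith) n
    _ = 2 * ((2 * p / a) ^ (p - 1) * (2 / a)) * ((n : ℝ) ^ (a / 2) * (n : ℝ) ^ (a / 2)) := by
        field_simp
    _ ≤ 2 ^ p * ((2 * p / a) ^ (p - 1) * (2 * p / a)) * ((n : ℝ) ^ (a / 2) * (n : ℝ) ^ (a / 2)) := by
        have : (2 : ℝ) ≤ 2 ^ p := Real.self_le_rpow_of_one_le (by norm_num) hp
        gcongr
        linarith
    _ = _ := by
        rw [← Real.rpow_add_one (by positivity), ← Real.rpow_add hn0, sub_add_cancel, add_halves,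
          ← Real.mul_rpow (by positivity) (by positivity)]
        ring_nf

/-- For r ≤ 1/2 the threshold is (1-2r) ln n = p: below it the harmonic comparison is good enough,
above it the power bound is. For r > 1/2 each logarithm is replaced by 2 ln n and the weights are
nearly summable. -/
lemma logSum_le_coefA {n : ℕ} {r p : ℝ} (hn : 3 ≤ n) (hr0 : 0 ≤ r) (hp : 1 ≤ p) :
    logSum n r p ≤ coefA 8 n r p := by
  have hL := one_le_log hn
  unfold coefA
  set l := Real.log n with hl
  have hn0 : (0 : ℝ) < n := by positivity
  split_ifs with hr
  · have ha : 0 ≤ 1 - 2 * r := by linarith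
    rw [← Real.mul_rpow (by positivity) (by positivity), mul_right_comm,
      ← Real.mul_rpow (by positivity) (by positivity), mul_div_right_comm,
      ← Real.div_rpow (by positivity) (by positivity)]
    rcases le_total ((1 - 2 * r) * l) p with h | h
    · refine (logSum_le_of_small hn hr hp).trans ?_
      rw [mul_comm]
      gcongr
      rw [le_div_iff₀ (by positivity)]
      nlinarith
    · have ha0 : r < 1 / 2 := by
        by_contra hcon
        have : r = 1 / 2 := by linarith
        rw [this] at h
        norm_num at h
        linarith
      refine (logSum_le_of_pos hn hr0 ha0 hp).trans ?_
      have ha1 : 0 < 1 - 2 * r := by linarith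
      have hbase : 4 * p / (1 - 2 * r) ≤ 8 * p * l / (p + (1 - 2 * r) * l) := by
        rw [div_le_div_iff₀ ha1 (by positivity)]
        nlinarith
      gcongr
  · rw [not_le] at hr
    have hb : 0 < 2 * r - 1 := by linarith
    calc logSum n r p
        ≤ ∑ i ∈ Finset.Icc 1 n, (2 * l) ^ (p - 1) * (i : ℝ) ^ (-1 - (2 * r - 1)) := by
          refine Finset.sum_le_sum fun i hi => ?_
          rw [Finset.mem_Icc] at hi
          have h1 := one_le_one_add_log_div hi.1 hi.2
          have h2 := log_div_le_log hi.1 hi.2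
          rw [show -1 - (2 * r - 1) = -2 * r by ring, mul_comm]
          gcongr
          linarith
      _ ≤ (2 * l) ^ (p - 1) * (1 + 2 * (l / (1 + (2 * r - 1) * l))) := by
          rw [← Finset.mul_sum]
          gcongr
          exact sum_rpow_le_of_pos hb hn
      _ ≤ (2 * l) ^ (p - 1) * (2 * 1 + 2 * (l / (1 + (2 * r - 1) * l))) := by
          gcongr
          norm_num
      _ = 2 ^ p * l ^ p / (1 + (2 * r - 1) * l) + 2 ^ p * l ^ (p - 1) := by
          rw [Real.mul_rpow (by norm_num) (by positivity), Real.rpow_sub_one (by norm_num),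
            Real.rpow_sub_one (by positivity)]
          field_simp
          ring
      _ ≤ _ := by
          gcongr <;> norm_num

/-! Hölder's inequality and restriction to `i ≤ n / e` -/

lemma sum_rpow_mul_rpow_le {ι : Type*} (s : Finset ι) {A B : ι → ℝ} {θ : ℝ} (h0 : 0 ≤ θ) (h1 : θ < 1)
    (hA : ∀ i ∈ s, 0 ≤ A i) (hB : ∀ i ∈ s, 0 ≤ B i) :
    ∑ i ∈ s, A i ^ θ * B i ^ (1 - θ) ≤ (∑ i ∈ s, A i) ^ θ * (∑ i ∈ s, B i) ^ (1 - θ) := by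
  -- θ = 0, which occurs at p = 1, has no finite conjugate exponent; there A_i^0 = 1 even where A_i
  -- = 0, and both sides agree.
  rcases h0.eq_or_lt with rfl | h0
  · simp
  have h := Real.inner_le_Lp_mul_Lq_of_nonneg (s := s) (p := θ⁻¹) (q := (1 - θ)⁻¹)
    (f := fun i => A i ^ θ) (g := fun i => B i ^ (1 - θ))
    (by
      refine Real.holderConjugate_iff.2 ⟨(one_lt_inv₀ h0).2 h1, ?_⟩
      simp)
    (fun i hi => Real.rpow_nonneg (hA i hi) _) (fun i hi => Real.rpow_nonneg (hB i hi) _)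
  refine h.trans_eq ?_
  have h1' : 1 - θ ≠ 0 := by linarith
  rw [one_div, inv_inv, one_div, inv_inv]
  congr 2
  · exact Finset.sum_congr rfl fun i hi => by
      rw [← Real.rpow_mul (hA i hi), mul_inv_cancel₀ h0.ne', Real.rpow_one]
  · exact Finset.sum_congr rfl fun i hi => by
      rw [← Real.rpow_mul (hB i hi), mul_inv_cancel₀ h1', Real.rpow_one]

lemma mem_idx {n i : ℕ} : i ∈ idx n ↔ 1 ≤ i ∧ (i : ℝ) ≤ n / Real.exp 1 := by
  rw [idx, Finset.mem_Icc, Nat.le_floor_iff (by positivity)]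

lemma idx_subset (n : ℕ) : idx n ⊆ Finset.Icc 1 n := by
  refine Finset.Icc_subset_Icc le_rfl (Nat.floor_le_of_le ?_)
  exact div_le_self (by positivity) (Real.one_le_exp (by norm_num))

lemma one_mem_idx {n : ℕ} (hn : 3 ≤ n) : 1 ∈ idx n := by
  rw [mem_idx, le_div_iff₀ (Real.exp_pos 1)]
  have h3 : (3 : ℝ) ≤ n := by exact_mod_cast hn
  exact ⟨le_rfl, by push_cast; linarith [Real.exp_one_lt_d9]⟩

lemma one_le_log_div {n i : ℕ} (hi : i ∈ idx n) : 1 ≤ Real.log (n / i) := by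
  rw [mem_idx, le_div_iff₀ (Real.exp_pos 1)] at hi
  have hi0 : (0 : ℝ) < i := by exact_mod_cast hi.1
  have h := (le_div_iff₀' hi0).2 hi.2
  rwa [Real.le_log_iff_exp_le ((Real.exp_pos 1).trans_le h)]

/-- With m = ⌊n/e⌋ ≥ 1 one has n < e(m+1) ≤ 2em < 6m. The at most 5m terms beyond m are each at most
f(m), and m f(m) is at most the sum up to m. -/
lemma sum_le_six_mul_sum_idx {n : ℕ} (hn : 3 ≤ n) {f : ℕ → ℝ}
    (hf : AntitoneOn f (Set.Icc 1 n)) (h0 : ∀ i ∈ Finset.Icc 1 n, 0 ≤ f i) :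
    ∑ i ∈ Finset.Icc 1 n, f i ≤ 6 * ∑ i ∈ idx n, f i := by
  have h1 := one_mem_idx hn
  have hsub := idx_subset n
  rw [idx] at *
  set m := ⌊(n : ℝ) / Real.exp 1⌋₊ with hm
  rw [Finset.mem_Icc] at h1
  have hmn : m ≤ n := (Finset.mem_Icc.1 (hsub (Finset.mem_Icc.2 ⟨h1.2, le_rfl⟩))).2
  have hn6 : n ≤ 6 * m := by
    have h2 := Nat.lt_floor_add_one ((n : ℝ) / Real.exp 1)
    rw [← hm, div_lt_iff₀ (Real.exp_pos 1)] at h2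
    have h3 : (1 : ℝ) ≤ m := by exact_mod_cast h1.2
    have h4 : (n : ℝ) ≤ 6 * m := by nlinarith [Real.exp_one_lt_d9]
    exact_mod_cast h4
  have hfm : 0 ≤ f m := h0 m (Finset.mem_Icc.2 ⟨h1.2, hmn⟩)
  have hA : (m : ℝ) * f m ≤ ∑ i ∈ Finset.Icc 1 m, f i := by
    have := Finset.card_nsmul_le_sum (Finset.Icc 1 m) f (f m) fun i hi => by
      rw [Finset.mem_Icc] at hi
      exact hf ⟨hi.1, hi.2.trans hmn⟩ ⟨h1.2, hmn⟩ hi.2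
    simpa using this
  have hB : ∑ i ∈ Finset.Icc 1 n \ Finset.Icc 1 m, f i ≤ 5 * m * f m := by
    have h5 := Finset.sum_le_card_nsmul (Finset.Icc 1 n \ Finset.Icc 1 m) f (f m) fun i hi => by
      rw [Finset.mem_sdiff, Finset.mem_Icc, Finset.mem_Icc] at hi
      exact hf ⟨h1.2, hmn⟩ hi.1 (by omega)
    refine h5.trans ?_
    rw [nsmul_eq_mul, Finset.card_sdiff_of_subset hsub]
    gcongr
    have : (Finset.Icc 1 n).card - (Finset.Icc 1 m).card ≤ 5 * m := by simp; omega
    exact_mod_cast this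
  rw [← Finset.sum_sdiff hsub]
  linarith

/-! The non-increasing rearrangement -/

/-- The permutation that sorts `|x_1|, …, |x_n|` in non-increasing order. -/
noncomputable def sortPerm {n : ℕ} (x : E n) : Equiv.Perm (Fin n) := Tuple.sort (fun j : Fin n => -|x j|)

lemma ord_succ {n : ℕ} (x : E n) (j : Fin n) : ord x (j + 1) = |x (sortPerm x j)| := by
  have h : 1 ≤ (j : ℕ) + 1 ∧ (j : ℕ) + 1 ≤ n := ⟨by omega, by omega⟩
  rw [ord, dif_pos h]
  rfl

lemma ord_nonneg {n : ℕ} (x : E n) (i : ℕ) : 0 ≤ ord x i := by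
  rw [ord]
  split_ifs <;> positivity

lemma antitone_abs_sortPerm {n : ℕ} (x : E n) : Antitone fun j => |x (sortPerm x j)| := by
  intro i j hij
  have := Tuple.monotone_sort (fun j : Fin n => -|x j|) hij
  simpa [sortPerm] using this

lemma ord_antitoneOn {n : ℕ} (x : E n) : AntitoneOn (ord x) (Set.Icc 1 n) := by
  intro i hi j hj hij
  have h := antitone_abs_sortPerm x (a := ⟨i - 1, by have := hi.1; have := hi.2; omega⟩)
    (b := ⟨j - 1, by have := hj.1; have := hj.2; omega⟩) (by simp; omega)
  simp only [← ord_succ] at h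
  rwa [Nat.sub_add_cancel hi.1, Nat.sub_add_cancel hj.1] at h

lemma sum_Icc_eq_sum_fin {n : ℕ} (g : ℕ → ℝ) :
    ∑ i ∈ Finset.Icc 1 n, g i = ∑ j : Fin n, g (j + 1) := by
  rw [Fin.sum_univ_eq_sum_range (fun i => g (i + 1)) n, Finset.range_eq_Ico,
    Finset.sum_Ico_add' g 0 n 1]
  rfl

lemma sum_ord {n : ℕ} (x : E n) (g : ℕ → ℝ → ℝ) :
    ∑ i ∈ Finset.Icc 1 n, g i (ord x i) = ∑ j : Fin n, g (j + 1) |x (sortPerm x j)| := by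
  rw [sum_Icc_eq_sum_fin fun i => g i (ord x i)]
  simp only [ord_succ]

/-- This is how a union bound over coordinate sets, which ignores the ordering, controls order
statistics. -/
lemma exists_sum_sq_eq {n k : ℕ} (x : E n) (hk : k ≤ n) :
    ∃ T : Finset (Fin n), T.card = k ∧ ∑ i ∈ Finset.Icc 1 k, ord x i ^ 2 = ∑ j ∈ T, x j ^ 2 := by
  refine ⟨(Finset.univ.map (Fin.castLEEmb hk)).map (sortPerm x).toEmbedding, by simp, ?_⟩
  rw [sum_Icc_eq_sum_fin fun i => ord x i ^ 2, Finset.sum_map, Finset.sum_map]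
  refine Finset.sum_congr rfl fun j _ => ?_
  have := ord_succ x (Fin.castLE hk j)
  simp only [Fin.val_castLE] at this
  rw [this, sq_abs]
  rfl

lemma sum_ord_sq {n : ℕ} (x : E n) : ∑ i ∈ Finset.Icc 1 n, ord x i ^ 2 = ‖x‖ ^ 2 := by
  rw [sum_ord x fun _ u => u ^ 2, EuclideanSpace.real_norm_sq_eq,
    Equiv.sum_comp (sortPerm x) fun j => |x j| ^ 2]
  simp only [sq_abs]

lemma abs_le_ord_one {n : ℕ} (x : E n) (j : Fin n) : |x j| ≤ ord x 1 := by
  have hn : 0 < n := j.pos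
  have h := antitone_abs_sortPerm x (a := ⟨0, hn⟩) (b := (sortPerm x).symm j)
    (Nat.zero_le _)
  have h1 := ord_succ x ⟨0, hn⟩
  simp only [zero_add] at h1
  rw [h1]
  simpa using h

/-- The rearrangement inequality: non-increasing weights pair best with the sorted values. The
weighted sum is thus a maximum over permutations, which is the source of convexity. -/
lemma sum_perm_le_sum_ord {n : ℕ} {c : ℕ → ℝ} (hc : AntitoneOn c (Set.Icc 1 n)) {q : ℝ}
    (hq : 0 ≤ q) (x : E n) (τ : Equiv.Perm (Fin n)) :
    ∑ j : Fin n, c (j + 1) * |x (τ j)| ^ q ≤ ∑ i ∈ Finset.Icc 1 n, c i * ord x i ^ q := by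
  rw [sum_ord x fun i u => c i * u ^ q]
  have hmono : Monovary (fun j : Fin n => c (j + 1)) (fun j => |x (sortPerm x j)| ^ q) := by
    refine Antitone.monovary (fun i j hij => ?_) (fun i j hij => ?_)
    · exact hc ⟨by omega, by omega⟩ ⟨by omega, by omega⟩ (by simpa using hij)
    · exact Real.rpow_le_rpow (abs_nonneg _) (antitone_abs_sortPerm x hij) hq
  have h := hmono.sum_mul_comp_perm_le_sum_mul (σ := τ.trans (sortPerm x).symm)
  simpa using h

lemma isNorm_rpow_sum {n : ℕ} (hn : 1 ≤ n) {c : ℕ → ℝ} {q : ℝ} (hq : 1 ≤ q)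
    (hc : AntitoneOn c (Set.Icc 1 n)) (h0 : ∀ i ∈ Finset.Icc 1 n, 0 ≤ c i) (h1 : 0 < c 1) :
    IsNorm fun x : E n => (∑ i ∈ Finset.Icc 1 n, c i * ord x i ^ q) ^ (1 / q) := by
  have hq0 : 0 < q := by linarith
  have hcj : ∀ j : Fin n, 0 ≤ c (j + 1) := fun j => h0 _ (by simp)
  have hW : ∀ x : E n, 0 ≤ ∑ i ∈ Finset.Icc 1 n, c i * ord x i ^ q := fun x =>
    Finset.sum_nonneg fun i hi => mul_nonneg (h0 i hi) (Real.rpow_nonneg (ord_nonneg x i) _)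
  have hzero : (∑ i ∈ Finset.Icc 1 n, c i * ord (0 : E n) i ^ q) ^ (1 / q) = 0 := by
    rw [sum_ord (0 : E n) fun i u => c i * u ^ q]
    simp [Real.zero_rpow hq0.ne', Real.zero_rpow (inv_ne_zero hq0.ne')]
  have hadd : ∀ x y : E n, (∑ i ∈ Finset.Icc 1 n, c i * ord (x + y) i ^ q) ^ (1 / q) ≤
      (∑ i ∈ Finset.Icc 1 n, c i * ord x i ^ q) ^ (1 / q)
        + (∑ i ∈ Finset.Icc 1 n, c i * ord y i ^ q) ^ (1 / q) := by
    intro x y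
    have hpow : ∀ (j : Fin n) (u : ℝ), |c (j + 1) ^ (1 / q) * u| ^ q = c (j + 1) * |u| ^ q := by
      intro j u
      rw [abs_mul, Real.mul_rpow (abs_nonneg _) (abs_nonneg _),
        abs_of_nonneg (Real.rpow_nonneg (hcj j) _), ← Real.rpow_mul (hcj j),
        one_div_mul_cancel hq0.ne', Real.rpow_one]
    -- Minkowski is applied along the single permutation that sorts x + y; for x and y separately
    -- that permutation can only lower the weighted sum.
    have h := Real.Lp_add_le Finset.univ
      (fun j : Fin n => c (j + 1) ^ (1 / q) * x (sortPerm (x + y) j))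
      (fun j : Fin n => c (j + 1) ^ (1 / q) * y (sortPerm (x + y) j)) hq
    simp only [← mul_add, hpow] at h
    rw [sum_ord (x + y) fun i u => c i * u ^ q]
    refine h.trans (add_le_add ?_ ?_)
    · exact Real.rpow_le_rpow (Finset.sum_nonneg fun j _ => mul_nonneg (hcj j) (by positivity))
        (sum_perm_le_sum_ord hc hq0.le x _) (by positivity)
    · exact Real.rpow_le_rpow (Finset.sum_nonneg fun j _ => mul_nonneg (hcj j) (by positivity))
        (sum_perm_le_sum_ord hc hq0.le y _) (by positivity)
  have hsmul : ∀ (a : ℝ) (x : E n), (∑ i ∈ Finset.Icc 1 n, c i * ord (a • x) i ^ q) ^ (1 / q) ≤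
      ‖a‖ * (∑ i ∈ Finset.Icc 1 n, c i * ord x i ^ q) ^ (1 / q) := by
    intro a x
    have h : ∑ i ∈ Finset.Icc 1 n, c i * ord (a • x) i ^ q
        ≤ |a| ^ q * ∑ i ∈ Finset.Icc 1 n, c i * ord x i ^ q := by
      rw [sum_ord (a • x) fun i u => c i * u ^ q]
      refine le_trans (le_of_eq ?_) (mul_le_mul_of_nonneg_left
        (sum_perm_le_sum_ord hc hq0.le x (sortPerm (a • x))) (by positivity))
      rw [Finset.mul_sum]
      refine Finset.sum_congr rfl fun j _ => ?_
      rw [PiLp.smul_apply, smul_eq_mul, abs_mul, Real.mul_rpow (abs_nonneg _) (abs_nonneg _)]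
      ring
    refine (Real.rpow_le_rpow (hW _) h (by positivity)).trans_eq ?_
    rw [Real.mul_rpow (by positivity) (hW x), ← Real.rpow_mul (abs_nonneg a),
      mul_one_div_cancel hq0.ne', Real.rpow_one, Real.norm_eq_abs]
  refine ⟨Seminorm.ofSMulLE _ hzero hadd hsmul, fun x => rfl, fun x hx => ?_⟩
  change (∑ i ∈ Finset.Icc 1 n, c i * ord x i ^ q) ^ (1 / q) = 0 at hx
  rw [Real.rpow_eq_zero (hW x) (by positivity),
    Finset.sum_eq_zero_iff_of_nonneg fun i hi =>
      mul_nonneg (h0 i hi) (Real.rpow_nonneg (ord_nonneg x i) _)] at hx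
  have h2 := hx 1 (Finset.mem_Icc.2 ⟨le_rfl, hn⟩)
  rw [mul_eq_zero, or_iff_right h1.ne', Real.rpow_eq_zero (ord_nonneg x 1) hq0.ne'] at h2
  ext j
  have h3 := abs_le_ord_one x j
  rw [h2] at h3
  simpa using abs_nonpos_iff.1 h3

lemma isNorm_sum {n : ℕ} (hn : 1 ≤ n) {c : ℕ → ℝ} (hc : AntitoneOn c (Set.Icc 1 n))
    (h0 : ∀ i ∈ Finset.Icc 1 n, 0 ≤ c i) (h1 : 0 < c 1) :
    IsNorm fun x : E n => ∑ i ∈ Finset.Icc 1 n, c i * ord x i := by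
  simpa using isNorm_rpow_sum hn le_rfl hc h0 h1

/-- Extending the positive coefficients by zero beyond n/e keeps them non-increasing on the whole
range. -/
lemma isNorm_sum_idx {n : ℕ} (hn : 3 ≤ n) {c : ℕ → ℝ} (hc : AntitoneOn c (idx n))
    (h0 : ∀ i ∈ idx n, 0 < c i) :
    IsNorm fun x : E n => ∑ i ∈ idx n, c i * ord x i := by
  have h := isNorm_sum (n := n) (by omega) (c := fun i => if i ∈ idx n then c i else 0) ?_ ?_ ?_
  · convert h using 2 with x
    simp only [ite_mul, zero_mul]
    rw [← Finset.sum_filter, Finset.filter_mem_eq_inter,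
      Finset.inter_eq_right.2 (idx_subset n)]
  · intro i hi j hj hij
    dsimp only
    by_cases hj' : j ∈ idx n
    · have hi' : i ∈ idx n := by
        rw [idx, Finset.mem_Icc] at *
        exact ⟨hi.1, hij.trans hj'.2⟩
      rw [if_pos hj', if_pos hi']
      exact hc hi' hj' hij
    · rw [if_neg hj']
      split_ifs with hi'
      · exact (h0 i hi').le
      · rfl
  · intro i _
    split_ifs with hi'
    · exact (h0 i hi').le
    · rfl
  · rw [if_pos (one_mem_idx hn)]
    exact h0 1 (one_mem_idx hn)

/-! Gaussian tail bounds -/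

lemma mgf_sq_gaussianReal {l : ℝ} (hl : l < 1 / 2) :
    mgf (fun x : ℝ => x ^ 2) (gaussianReal 0 1) l = √(1 / (1 - 2 * l)) := by
  rw [mgf, integral_gaussianReal_eq_integral_smul (by norm_num)]
  have h : ∀ x : ℝ, gaussianPDFReal 0 1 x • Real.exp (l * x ^ 2)
      = (√(2 * Real.pi))⁻¹ * Real.exp (-(1 / 2 - l) * x ^ 2) := by
    intro x
    rw [gaussianPDFReal, smul_eq_mul, mul_assoc, ← Real.exp_add]
    simp only [NNReal.coe_one, mul_one, sub_zero]
    congr 2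
    ring
  simp_rw [h]
  rw [integral_const_mul, integral_gaussian, ← Real.sqrt_inv, ← Real.sqrt_mul (by positivity)]
  congr 1
  have h1 : 1 - 2 * l ≠ 0 := by linarith
  have h2 : 1 / 2 - l ≠ 0 := by linarith
  have := Real.pi_ne_zero
  field_simp

lemma integrable_exp_mul_sq {l : ℝ} (hl : l < 1 / 2) :
    Integrable (fun x : ℝ => Real.exp (l * x ^ 2)) (gaussianReal 0 1) := by
  -- The integral of a non-integrable function is 0 by convention, so the positive value of the
  -- moment generating function already forces integrability.
  refine Integrable.of_integral_ne_zero ?_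
  have h := mgf_sq_gaussianReal hl
  rw [mgf] at h
  rw [h]
  have : 0 < 1 - 2 * l := by linarith
  positivity

lemma stdGaussian_sum_sq_ge_le {n : ℕ} (T : Finset (Fin n)) {l : ℝ} (h0 : 0 ≤ l) (hl : l < 1 / 2)
    (s : ℝ) :
    (stdGaussian (E n)).real {x | s ≤ ∑ j ∈ T, x j ^ 2}
      ≤ Real.exp (-l * s) * √(1 / (1 - 2 * l)) ^ T.card := by
  rw [← map_pi_eq_stdGaussian, map_measureReal_apply (by fun_prop)
    (measurableSet_le (by fun_prop) (by fun_prop))]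
  set μ : Measure (Fin n → ℝ) := Measure.pi fun _ => gaussianReal 0 1 with hμ
  set X : Fin n → (Fin n → ℝ) → ℝ := fun j y => y j ^ 2 with hX
  have hmeas : ∀ j, Measurable (X j) := fun j => by fun_prop
  have hind : iIndepFun X μ :=
    iIndepFun_pi (X := fun _ (u : ℝ) => u ^ 2) fun j => by fun_prop
  have hmp : ∀ j, MeasurePreserving (fun y : Fin n → ℝ => y j) μ (gaussianReal 0 1) := fun j =>
    measurePreserving_eval _ j
  have hmgf : ∀ j, mgf (X j) μ l = √(1 / (1 - 2 * l)) := by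
    intro j
    rw [← mgf_sq_gaussianReal hl, ← (hmp j).map_eq]
    exact (mgf_map (X := fun u : ℝ => u ^ 2) (measurable_pi_apply j).aemeasurable
      (Measurable.aestronglyMeasurable (by fun_prop))).symm
  have hint : ∀ j, Integrable (fun y => Real.exp (l * X j y)) μ := fun j =>
    (hmp j).integrable_comp_of_integrable (integrable_exp_mul_sq hl)
  have h := measure_ge_le_exp_mul_mgf (μ := μ) (X := ∑ j ∈ T, X j) s h0
    (hind.integrable_exp_mul_sum hmeas fun j _ => hint j)
  rw [hind.mgf_sum hmeas, Finset.prod_congr rfl fun j _ => hmgf j, Finset.prod_const] at h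
  refine le_trans (le_of_eq ?_) h
  congr 1
  ext y
  simp [hX]

/-- Passing through a measurable G inside the sublevel set means that no measurability of N has to
be shown. -/
lemma gaussianBound_of_forall_mem {n : ℕ} {C t S : ℝ} {N : E n → ℝ} {G : Set (E n)}
    (hG : MeasurableSet G) (hP : (stdGaussian (E n)).real Gᶜ ≤ C * Real.exp (-t ^ 2 / 2))
    (hN : ∀ x ∈ G, N x ≤ S) : GaussianBound.{u} C t N S := by
  intro Ω _ P _ X hX
  have h1 : P.real (X ⁻¹' G) = (stdGaussian (E n)).real G := by
    rw [← hX.map_eq, map_measureReal_apply_of_aemeasurable hX.aemeasurable hG]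
  have h2 : P.real (X ⁻¹' G) ≤ P.real {ω | N (X ω) ≤ S} :=
    measureReal_mono fun ω hω => hN _ hω
  have h3 := probReal_compl_eq_one_sub (μ := stdGaussian (E n)) hG
  linarith

/-- The event that, for all `k`, the sum of the `k` largest squares is at most
`8 (k ln (en/k) + t²)`. -/
def goodSet (n : ℕ) (t : ℝ) : Set (E n) :=
  {x | ∀ T : Finset (Fin n), T.Nonempty →
    ∑ j ∈ T, x j ^ 2 ≤ 8 * (T.card * (1 + Real.log (n / T.card)) + t ^ 2)}

lemma measurableSet_goodSet (n : ℕ) (t : ℝ) : MeasurableSet (goodSet n t) := by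
  simp only [goodSet, Set.ofPred_forall]
  exact MeasurableSet.iInter fun T => MeasurableSet.iInter fun _ =>
    measurableSet_le (by fun_prop) (by fun_prop)

lemma choose_le_exp {n k : ℕ} (hk : 1 ≤ k) (hn : 1 ≤ n) :
    (n.choose k : ℝ) ≤ Real.exp (k * (1 + Real.log (n / k))) := by
  have hk0 : (0 : ℝ) < k := by exact_mod_cast hk
  have hn0 : (0 : ℝ) < n := by exact_mod_cast hn
  calc (n.choose k : ℝ) ≤ (n : ℝ) ^ k / k.factorial := Nat.choose_le_pow_div k n
    _ = ((n : ℝ) / k) ^ k * ((k : ℝ) ^ k / k.factorial) := by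
        rw [div_pow]
        field_simp
    _ ≤ ((n : ℝ) / k) ^ k * Real.exp k := by
        gcongr
        exact Real.pow_div_factorial_le_exp _ hk0.le k
    _ = _ := by
        rw [mul_add, mul_one, Real.exp_add, Real.exp_nat_mul, Real.exp_log (by positivity), mul_comm]

/-- Chernoff with parameter 1/4 bounds each k-set by exp(-2k ln(en/k) - 2t²) 2^{k/2}. One copy of k
ln(en/k) pays for the binomial coefficient; the other is at least k and leaves (2/e)^k ≤ (3/4)^k,
whose sum is at most 4. -/
lemma stdGaussian_goodSet_compl_le {n : ℕ} (hn : 1 ≤ n) (t : ℝ) :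
    (stdGaussian (E n)).real (goodSet n t)ᶜ ≤ 4 * Real.exp (-t ^ 2 / 2) := by
  -- The empty set is excluded from the event, so k = 0 contributes nothing.
  set b : ℕ → ℝ := fun k => if k = 0 then 0 else
    Real.exp (-(1 / 4) * (8 * (k * (1 + Real.log (n / k)) + t ^ 2)))
      * √(1 / (1 - 2 * (1 / 4))) ^ k with hb
  have hsub : (goodSet n t)ᶜ ⊆ ⋃ T ∈ (Finset.univ : Finset (Fin n)).powerset,
      {x : E n | T.Nonempty ∧
        8 * (T.card * (1 + Real.log (n / T.card)) + t ^ 2) ≤ ∑ j ∈ T, x j ^ 2} := by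
    intro x hx
    simp only [goodSet, Set.mem_compl_iff, Set.mem_ofPred_eq, not_forall, not_le] at hx
    obtain ⟨T, hT, h⟩ := hx
    simp only [Set.mem_iUnion, Set.mem_ofPred_eq]
    exact ⟨T, by simp, hT, h.le⟩
  refine (measureReal_mono hsub (measure_ne_top _ _)).trans ((measureReal_biUnion_finset_le _ _).trans ?_)
  have hT : ∀ T ∈ (Finset.univ : Finset (Fin n)).powerset, (stdGaussian (E n)).real
      {x : E n | T.Nonempty ∧
        8 * (T.card * (1 + Real.log (n / T.card)) + t ^ 2) ≤ ∑ j ∈ T, x j ^ 2} ≤ b T.card := by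
    intro T _
    rcases T.eq_empty_or_nonempty with rfl | hne
    · simp [hb]
    · simp only [hne, true_and, hb, if_neg hne.card_pos.ne']
      exact stdGaussian_sum_sq_ge_le T (by norm_num) (by norm_num) _
  refine (Finset.sum_le_sum hT).trans ?_
  rw [Finset.sum_powerset_apply_card, Finset.card_univ, Fintype.card_fin]
  have hk : ∀ k ∈ Finset.range (n + 1), n.choose k • b k
      ≤ (3 / 4 : ℝ) ^ k * Real.exp (-t ^ 2 / 2) := by
    intro k hk
    rw [Finset.mem_range] at hk
    rcases Nat.eq_zero_or_pos k with rfl | hk0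
    · simp [hb]
      positivity
    · have hlog := one_le_one_add_log_div (n := n) hk0 (by omega)
      have hk1 : (1 : ℝ) ≤ k := by exact_mod_cast hk0
      simp only [hb, if_neg hk0.ne', nsmul_eq_mul]
      have hs : √(1 / (1 - 2 * (1 / 4))) ≤ 2 := by
        rw [Real.sqrt_le_left (by norm_num)]
        norm_num
      calc (n.choose k : ℝ) * (Real.exp (-(1 / 4) * (8 * (k * (1 + Real.log (n / k)) + t ^ 2)))
            * √(1 / (1 - 2 * (1 / 4))) ^ k)
          ≤ Real.exp (k * (1 + Real.log (n / k)))
            * (Real.exp (-(1 / 4) * (8 * (k * (1 + Real.log (n / k)) + t ^ 2))) * 2 ^ k) := by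
            gcongr
            exact choose_le_exp hk0 hn
        _ = 2 ^ k * Real.exp (-(k * (1 + Real.log (n / k))) - 2 * t ^ 2) := by
            rw [← mul_assoc, ← Real.exp_add, mul_comm]
            ring_nf
        _ ≤ 2 ^ k * Real.exp (k * (-1) + -t ^ 2 / 2) := by
            gcongr
            nlinarith [sq_nonneg t]
        _ = (2 * Real.exp (-1)) ^ k * Real.exp (-t ^ 2 / 2) := by
            rw [Real.exp_add, Real.exp_nat_mul, mul_pow]
            ring
        _ ≤ _ := by
            gcongr
            rw [Real.exp_neg, ← div_eq_mul_inv, div_le_iff₀ (Real.exp_pos 1)]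
            linarith [Real.exp_one_gt_d9]
  refine (Finset.sum_le_sum hk).trans ?_
  rw [← Finset.sum_mul]
  gcongr
  have := (summable_geometric_of_lt_one (r := (3 / 4 : ℝ)) (by norm_num) (by norm_num)).sum_le_tsum
    (Finset.range (n + 1)) fun i _ => by positivity
  rw [tsum_geometric_of_lt_one (by norm_num) (by norm_num)] at this
  norm_num at this ⊢
  exact this

lemma gaussianBound_of_goodSet {n : ℕ} (hn : 1 ≤ n) {t S : ℝ} {N : E n → ℝ}
    (hN : ∀ x ∈ goodSet n t, N x ≤ S) : GaussianBound.{u} 4 t N S :=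
  gaussianBound_of_forall_mem (measurableSet_goodSet n t) (stdGaussian_goodSet_compl_le hn t) hN

lemma gaussianBound_norm {n : ℕ} (hn : 1 ≤ n) {t : ℝ} (ht : 0 < t) :
    GaussianBound.{u} 1 t (fun x : E n => ‖x‖) ((n : ℝ) ^ (1 / 2 : ℝ) + t) := by
  rw [← Real.sqrt_eq_rpow]
  have hn0 : (0 : ℝ) < n := by exact_mod_cast hn
  set q := √(n : ℝ) with hq
  have hq0 : 0 < q := Real.sqrt_pos.2 hn0
  have hqn : q ^ 2 = n := Real.sq_sqrt hn0.le
  refine gaussianBound_of_forall_mem (G := {x | ‖x‖ ≤ q + t})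
    (measurableSet_le (by fun_prop) (by fun_prop)) ?_ fun x hx => hx
  set s := q + t with hs
  have hs0 : 0 < s := by positivity
  have hqs : q ^ 2 ≤ s ^ 2 := by gcongr; linarith
  have h1 : q ^ 2 / s ^ 2 ≤ 1 := (div_le_one (by positivity)).2 hqs
  have h2 : 0 < q ^ 2 / s ^ 2 := by positivity
  -- With s = √n + t this is the optimal Chernoff parameter. The moment factor becomes (s/√n)^n = (1
  -- + t/√n)^n ≤ e^{t√n}, which cancels the cross term of s² and leaves exactly exp(-t²/2).
  have h := stdGaussian_sum_sq_ge_le (n := n) Finset.univ (l := (1 - q ^ 2 / s ^ 2) / 2)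
    (by linarith) (by linarith) (s ^ 2)
  have hsub : {x : E n | ‖x‖ ≤ s}ᶜ ⊆ {x : E n | s ^ 2 ≤ ∑ j, x j ^ 2} := by
    intro x hx
    simp only [Set.mem_compl_iff, Set.mem_ofPred_eq, not_le] at hx
    rw [Set.mem_ofPred_eq, ← EuclideanSpace.real_norm_sq_eq]
    gcongr
  refine (measureReal_mono hsub).trans (h.trans ?_)
  have hsqrt : √(1 / (1 - 2 * ((1 - q ^ 2 / s ^ 2) / 2))) = s / q := by
    rw [show 1 / (1 - 2 * ((1 - q ^ 2 / s ^ 2) / 2)) = (s / q) ^ 2 by field_simp; ring,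
      Real.sqrt_sq (by positivity)]
  rw [hsqrt, Finset.card_univ, Fintype.card_fin, one_mul]
  have h3 : (s / q) ^ n ≤ Real.exp (q * t) := by
    calc (s / q) ^ n ≤ Real.exp (t / q) ^ n := by
          gcongr
          refine le_trans (le_of_eq ?_) (Real.add_one_le_exp _)
          rw [hs]
          field_simp
          ring
      _ = _ := by
          rw [← Real.exp_nat_mul, ← hqn]
          congr 1
          field_simp
  calc _ ≤ Real.exp (-((1 - q ^ 2 / s ^ 2) / 2) * s ^ 2) * Real.exp (q * t) := by gcongr
    _ = Real.exp (-t ^ 2 / 2) := by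
        rw [← Real.exp_add]
        congr 1
        field_simp
        rw [hs]
        ring
    _ ≤ _ := le_rfl

/-! Order statistics on the good event -/

lemma sum_ord_sq_le_of_mem_goodSet {n : ℕ} {t : ℝ} {x : E n} (hx : x ∈ goodSet n t) {k : ℕ}
    (hk : 1 ≤ k) (hkn : k ≤ n) :
    ∑ i ∈ Finset.Icc 1 k, ord x i ^ 2 ≤ 8 * (k * (1 + Real.log (n / k)) + t ^ 2) := by
  obtain ⟨T, hT, h⟩ := exists_sum_sq_eq x hkn
  rw [h, ← hT]
  exact hx T (Finset.card_pos.1 (by omega))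

lemma card_mul_ord_sq_le {n : ℕ} (x : E n) {k : ℕ} (hk : 1 ≤ k) (hkn : k ≤ n) :
    k * ord x k ^ 2 ≤ ∑ i ∈ Finset.Icc 1 k, ord x i ^ 2 := by
  have := Finset.card_nsmul_le_sum (Finset.Icc 1 k) (fun i => ord x i ^ 2) (ord x k ^ 2)
    fun i hi => by
      rw [Finset.mem_Icc] at hi
      exact pow_le_pow_left₀ (ord_nonneg x k)
        (ord_antitoneOn x ⟨hi.1, hi.2.trans hkn⟩ ⟨hk, hkn⟩ hi.2) 2
  simpa using this

lemma ord_sq_le_of_mem_goodSet {n : ℕ} {t : ℝ} {x : E n} (hx : x ∈ goodSet n t) {k : ℕ}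
    (hk : 1 ≤ k) (hkn : k ≤ n) :
    ord x k ^ 2 ≤ 8 * (1 + Real.log (n / k) + t ^ 2 / k) := by
  have h := (card_mul_ord_sq_le x hk hkn).trans (sum_ord_sq_le_of_mem_goodSet hx hk hkn)
  have hk0 : (0 : ℝ) < k := by exact_mod_cast hk
  refine le_of_mul_le_mul_left (h.trans_eq ?_) hk0
  field_simp

/-- The part of `x_[i]²` above `16 ln (en/i)`. -/
noncomputable def excess {n : ℕ} (x : E n) (i : ℕ) : ℝ :=
  max 0 (ord x i ^ 2 - 16 * (1 + Real.log (n / i)))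

lemma excess_nonneg {n : ℕ} (x : E n) (i : ℕ) : 0 ≤ excess x i := le_max_left _ _

lemma ord_sq_le_add_excess {n : ℕ} (x : E n) (i : ℕ) :
    ord x i ^ 2 ≤ 16 * (1 + Real.log (n / i)) + excess x i := by
  have := le_max_right 0 (ord x i ^ 2 - 16 * (1 + Real.log (n / i)))
  rw [excess]
  linarith

/-- Let k be the last index with positive excess. Then 16k ln(en/k) ≤ k x_[k]² ≤ 8(k ln(en/k) + t²),
so k ln(en/k) ≤ t². The sum of the k largest squares, which dominates the total excess, is then at
most 16t². -/
lemma sum_excess_le {n : ℕ} {t : ℝ} {x : E n} (hx : x ∈ goodSet n t) :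
    ∑ i ∈ Finset.Icc 1 n, excess x i ≤ 16 * t ^ 2 := by
  by_cases hI : ((Finset.Icc 1 n).filter fun i => 0 < excess x i).Nonempty
  · obtain ⟨k, hk⟩ : ∃ k, k = ((Finset.Icc 1 n).filter fun i => 0 < excess x i).max' hI := ⟨_, rfl⟩
    have hmem := Finset.max'_mem _ hI
    rw [← hk, Finset.mem_filter, Finset.mem_Icc] at hmem
    obtain ⟨⟨hk1, hkn⟩, hpos⟩ := hmem
    have hk0 : (0 : ℝ) < k := by exact_mod_cast hk1
    have hord : 16 * (1 + Real.log (n / k)) < ord x k ^ 2 := by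
      rw [excess, lt_max_iff] at hpos
      rcases hpos with h | h <;> linarith
    have h1 := card_mul_ord_sq_le x hk1 hkn
    have h2 := sum_ord_sq_le_of_mem_goodSet hx hk1 hkn
    have h3 : k * (16 * (1 + Real.log (n / k))) ≤ k * ord x k ^ 2 := by gcongr
    calc ∑ i ∈ Finset.Icc 1 n, excess x i = ∑ i ∈ Finset.Icc 1 k, excess x i := by
          symm
          refine Finset.sum_subset (Finset.Icc_subset_Icc le_rfl hkn) fun i hi hik => ?_
          refine le_antisymm (not_lt.1 fun hlt => hik ?_) (excess_nonneg x i)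
          rw [Finset.mem_Icc] at *
          refine ⟨hi.1, ?_⟩
          rw [hk]
          exact Finset.le_max' _ _ (by simpa [hi.1, hi.2] using hlt)
      _ ≤ ∑ i ∈ Finset.Icc 1 k, ord x i ^ 2 := by
          refine Finset.sum_le_sum fun i hi => ?_
          rw [Finset.mem_Icc] at hi
          have := one_le_one_add_log_div hi.1 (hi.2.trans hkn)
          exact max_le (by positivity) (by linarith)
      _ ≤ _ := by linarith
  · rw [Finset.not_nonempty_iff_eq_empty, Finset.filter_eq_empty_iff] at hI
    have : ∑ i ∈ Finset.Icc 1 n, excess x i ≤ 0 :=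
      Finset.sum_nonpos fun i hi => not_lt.1 (hI hi)
    nlinarith [sq_nonneg t]

/-! Inequalities for real powers -/

lemma add_rpow_le_two_rpow_mul {a b q : ℝ} (ha : 0 ≤ a) (hb : 0 ≤ b) (hq : 0 ≤ q) :
    (a + b) ^ q ≤ 2 ^ q * (a ^ q + b ^ q) := by
  calc (a + b) ^ q ≤ (2 * max a b) ^ q := by
        gcongr
        linarith [le_max_left a b, le_max_right a b]
    _ = 2 ^ q * max a b ^ q := Real.mul_rpow (by norm_num) (le_max_of_le_left ha)
    _ ≤ _ := by
        gcongr
        rcases max_cases a b with h | h <;> rw [h.1]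
        · linarith [Real.rpow_nonneg hb q]
        · linarith [Real.rpow_nonneg ha q]

lemma sum_rpow_le_rpow_sum {ι : Type*} (s : Finset ι) {f : ι → ℝ} (hf : ∀ i ∈ s, 0 ≤ f i) {q : ℝ}
    (hq : 1 ≤ q) : ∑ i ∈ s, f i ^ q ≤ (∑ i ∈ s, f i) ^ q := by
  classical
  induction s using Finset.induction_on with
  | empty => simp [Real.zero_rpow (by linarith : q ≠ 0)]
  | insert a s ha ih =>
    rw [Finset.sum_insert ha, Finset.sum_insert ha]
    have h0 : 0 ≤ ∑ i ∈ s, f i :=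
      Finset.sum_nonneg fun i hi => hf i (Finset.mem_insert_of_mem hi)
    have h1 := ih fun i hi => hf i (Finset.mem_insert_of_mem hi)
    have h2 := Real.add_rpow_le_rpow_add (hf a (Finset.mem_insert_self a s)) h0 hq
    linarith

lemma rpow_two_mul {u : ℝ} (hu : 0 ≤ u) (q : ℝ) : u ^ (2 * q) = (u ^ 2) ^ q := by
  rw [Real.rpow_mul hu, Real.rpow_two]

lemma rpow_le_self_of_one_le {c q : ℝ} (hc : 1 ≤ c) (hq : q ≤ 1) : c ^ q ≤ c := by
  simpa using Real.rpow_le_rpow_of_exponent_le hc hq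

lemma lorentzSum_nonneg {n : ℕ} (r p : ℝ) (x : E n) : 0 ≤ lorentzSum r p x :=
  Finset.sum_nonneg fun i _ => mul_nonneg (by positivity) (Real.rpow_nonneg (ord_nonneg x i) _)

/-! The norm with exponent `2 (p - 1) ≥ 1` -/

lemma logSum_nonneg (n : ℕ) (r p : ℝ) : 0 ≤ logSum n r p := by
  refine Finset.sum_nonneg fun i hi => ?_
  rw [Finset.mem_Icc] at hi
  have := one_le_one_add_log_div hi.1 hi.2
  positivity

lemma lorentzSum_le_logSum_add {n : ℕ} {r p : ℝ} (hp : 1 ≤ p) (x : E n) :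
    lorentzSum r p x ≤ 32 ^ (p - 1) * logSum n r p
      + 2 ^ (p - 1) * ∑ i ∈ Finset.Icc 1 n, (i : ℝ) ^ (-2 * r) * excess x i ^ (p - 1) := by
  rw [lorentzSum, logSum, Finset.mul_sum, Finset.mul_sum, ← Finset.sum_add_distrib]
  refine Finset.sum_le_sum fun i hi => ?_
  rw [Finset.mem_Icc] at hi
  have h1 := one_le_one_add_log_div hi.1 hi.2
  have hw := excess_nonneg x i
  rw [rpow_two_mul (ord_nonneg x i)]
  calc (i : ℝ) ^ (-2 * r) * (ord x i ^ 2) ^ (p - 1)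
      ≤ (i : ℝ) ^ (-2 * r) * (2 ^ (p - 1) * ((16 * (1 + Real.log (n / i))) ^ (p - 1)
          + excess x i ^ (p - 1))) := by
        gcongr
        refine le_trans ?_ (add_rpow_le_two_rpow_mul (by positivity) hw (by linarith))
        exact Real.rpow_le_rpow (by positivity) (ord_sq_le_add_excess x i) (by linarith)
    _ = _ := by
        rw [Real.mul_rpow (by norm_num) (by linarith), show (32 : ℝ) = 2 * 16 by norm_num,
          Real.mul_rpow (by norm_num) (by norm_num)]
        ring

lemma rpow_mul_coefA {c : ℝ} (hc : 0 ≤ c) (n : ℕ) (r p : ℝ) :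
    c ^ p * coefA 8 n r p = coefA (c * 8) n r p := by
  unfold coefA
  rw [Real.mul_rpow hc (by norm_num)]
  split_ifs <;> ring

/-- Here p - 1 ≥ 1, so the ℓ^{p-1} norm is at most the ℓ¹ norm, and the weights are at most 1. -/
lemma sum_mul_excess_rpow_le_of_two_le {n : ℕ} {r p t : ℝ} (hr : 0 ≤ r) (hp : 2 ≤ p) (ht : 0 < t)
    {x : E n} (hx : x ∈ goodSet n t) :
    ∑ i ∈ Finset.Icc 1 n, (i : ℝ) ^ (-2 * r) * excess x i ^ (p - 1)
      ≤ 16 ^ (p - 1) * t ^ (2 * (p - 1)) := by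
  calc ∑ i ∈ Finset.Icc 1 n, (i : ℝ) ^ (-2 * r) * excess x i ^ (p - 1)
      ≤ ∑ i ∈ Finset.Icc 1 n, excess x i ^ (p - 1) := by
        refine Finset.sum_le_sum fun i hi => ?_
        rw [Finset.mem_Icc] at hi
        refine mul_le_of_le_one_left (Real.rpow_nonneg (excess_nonneg x i) _) ?_
        exact Real.rpow_le_one_of_one_le_of_nonpos (by exact_mod_cast hi.1) (by linarith)
    _ ≤ (∑ i ∈ Finset.Icc 1 n, excess x i) ^ (p - 1) :=
        sum_rpow_le_rpow_sum _ (fun i _ => excess_nonneg x i) (by linarith)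
    _ ≤ (16 * t ^ 2) ^ (p - 1) :=
        Real.rpow_le_rpow (Finset.sum_nonneg fun i _ => excess_nonneg x i) (sum_excess_le hx)
          (by linarith)
    _ = _ := by rw [Real.mul_rpow (by norm_num) (by positivity), rpow_two_mul ht.le]

/-- Hölder with exponents p-1 on the excess and 2-p on the weights, written i^{-2r} =
(i^{η-1})^{2-p}, where η = (2-2r-p)/(2-p). Since 2-p ≤ 1, |η| ≥ |2-2r-p|, so the latter may stand in
the denominator. -/
lemma sum_mul_excess_rpow_le_of_lt_two {n : ℕ} {r p t : ℝ} (hn : 3 ≤ n) (hr : 0 ≤ r) (hp : 1 < p)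
    (hp2 : p < 2) (ht : 0 < t) {x : E n} (hx : x ∈ goodSet n t) :
    ∑ i ∈ Finset.Icc 1 n, (i : ℝ) ^ (-2 * r) * excess x i ^ (p - 1)
      ≤ 64 * (1 + (Real.log n / (1 + |2 - 2 * r - p| * Real.log n)) ^ (2 - p)
        * (1 + (n : ℝ) ^ (2 - 2 * r - p))) * t ^ (2 * (p - 1)) := by
  have hL := one_le_log hn
  have hn0 : (0 : ℝ) < n := by positivity
  set l := Real.log n with hl
  obtain ⟨δ, hδ⟩ : ∃ δ, δ = 2 - 2 * r - p := ⟨_, rfl⟩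
  obtain ⟨η, hη⟩ : ∃ η, η = δ / (2 - p) := ⟨_, rfl⟩
  have h2p : 0 < 2 - p := by linarith
  have hηδ : η * (2 - p) = δ := by rw [hη]; field_simp
  have hη1 : η ≤ 1 := by rw [hη, div_le_one h2p]; linarith
  have habs : |δ| ≤ |η| := by
    rw [← hηδ, abs_mul, abs_of_pos h2p]
    exact mul_le_of_le_one_right (abs_nonneg _) (by linarith)
  have hS : (∑ i ∈ Finset.Icc 1 n, (i : ℝ) ^ (η - 1)) ^ (2 - p)
      ≤ 4 * (1 + (l / (1 + |δ| * l)) ^ (2 - p) * (1 + (n : ℝ) ^ δ)) := by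
    have hQ : l / (1 + |η| * l) ≤ l / (1 + |δ| * l) := by gcongr
    have hQ0 : 0 ≤ l / (1 + |δ| * l) := by positivity
    calc (∑ i ∈ Finset.Icc 1 n, (i : ℝ) ^ (η - 1)) ^ (2 - p)
        ≤ (1 + 4 * (1 + (n : ℝ) ^ η) * (l / (1 + |δ| * l))) ^ (2 - p) := by
          refine Real.rpow_le_rpow (Finset.sum_nonneg fun i _ => by positivity) ?_ h2p.le
          refine (sum_rpow_le hη1 hn).trans ?_
          gcongr
      _ ≤ 1 ^ (2 - p) + (4 * (1 + (n : ℝ) ^ η) * (l / (1 + |δ| * l))) ^ (2 - p) :=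
          Real.rpow_add_le_add_rpow (by norm_num) (by positivity) h2p.le (by linarith)
      _ = 1 + 4 ^ (2 - p) * (1 + (n : ℝ) ^ η) ^ (2 - p) * (l / (1 + |δ| * l)) ^ (2 - p) := by
          rw [Real.one_rpow, Real.mul_rpow (by positivity) hQ0,
            Real.mul_rpow (by norm_num) (by positivity)]
      _ ≤ 1 + 4 * (1 + (n : ℝ) ^ δ) * (l / (1 + |δ| * l)) ^ (2 - p) := by
          have h4 : (4 : ℝ) ^ (2 - p) ≤ 4 := rpow_le_self_of_one_le (by norm_num) (by linarith)
          have h5 : (1 + (n : ℝ) ^ η) ^ (2 - p) ≤ 1 + (n : ℝ) ^ δ := by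
            refine (Real.rpow_add_le_add_rpow (by norm_num) (by positivity) h2p.le
              (by linarith)).trans_eq ?_
            rw [Real.one_rpow, ← Real.rpow_mul hn0.le, hηδ]
          gcongr
      _ ≤ _ := by linarith
  have hH := sum_rpow_mul_rpow_le (Finset.Icc 1 n) (A := excess x)
    (B := fun i : ℕ => (i : ℝ) ^ (η - 1)) (θ := p - 1) (by linarith) (by linarith)
    (fun i _ => excess_nonneg x i) (fun i _ => by positivity)
  rw [show 1 - (p - 1) = 2 - p by ring] at hH
  calc ∑ i ∈ Finset.Icc 1 n, (i : ℝ) ^ (-2 * r) * excess x i ^ (p - 1)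
      = ∑ i ∈ Finset.Icc 1 n, excess x i ^ (p - 1) * ((i : ℝ) ^ (η - 1)) ^ (2 - p) := by
        refine Finset.sum_congr rfl fun i _ => ?_
        rw [mul_comm, ← Real.rpow_mul (by positivity)]
        congr 2
        rw [sub_mul, hηδ, hδ]
        ring
    _ ≤ (16 * t ^ 2) ^ (p - 1)
        * (4 * (1 + (l / (1 + |δ| * l)) ^ (2 - p) * (1 + (n : ℝ) ^ δ))) := by
        refine hH.trans (mul_le_mul ?_ hS ?_ (by positivity))
        · exact Real.rpow_le_rpow (Finset.sum_nonneg fun i _ => excess_nonneg x i)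
            (sum_excess_le hx) (by linarith)
        · exact Real.rpow_nonneg (Finset.sum_nonneg fun i _ => by positivity) _
    _ ≤ (16 * t ^ (2 * (p - 1)))
        * (4 * (1 + (l / (1 + |δ| * l)) ^ (2 - p) * (1 + (n : ℝ) ^ δ))) := by
        rw [Real.mul_rpow (by norm_num) (by positivity), rpow_two_mul ht.le]
        have : (16 : ℝ) ^ (p - 1) ≤ 16 := rpow_le_self_of_one_le (by norm_num) (by linarith)
        gcongr
    _ = _ := by rw [hδ]; ring

lemma coefA_nonneg {C : ℝ} (hC : 0 ≤ C) {n : ℕ} (hn : 3 ≤ n) {r p : ℝ} (hp : 1 ≤ p) :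
    0 ≤ coefA C n r p := by
  have hL := one_le_log hn
  unfold coefA
  split_ifs with h
  · have : 0 ≤ 1 - 2 * r := by linarith
    positivity
  · have : 0 ≤ 2 * r - 1 := by linarith
    positivity

lemma lorentzSum_le_levelI {n : ℕ} {r p t : ℝ} (hn : 3 ≤ n) (hr : 0 ≤ r) (hp : 3 / 2 ≤ p)
    (ht : 0 < t) {x : E n} (hx : x ∈ goodSet n t) :
    lorentzSum r p x ≤ levelI 256 n r p t := by
  have hL := one_le_log hn
  refine (lorentzSum_le_logSum_add (by linarith) x).trans (add_le_add ?_ ?_)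
  -- The constant 256 = 32 · 8 is fixed here; the excess part needs only 2 · 64 when p < 2 and
  -- 32^{p-1} when p ≥ 2.
  · calc (32 : ℝ) ^ (p - 1) * logSum n r p ≤ 32 ^ p * coefA 8 n r p := by
          have h1 := logSum_le_coefA hn hr (by linarith : 1 ≤ p)
          have h2 := coefA_nonneg (C := 8) (by norm_num) hn (r := r) (by linarith : 1 ≤ p)
          have h0 := logSum_nonneg n r p
          have h3 : (32 : ℝ) ^ (p - 1) ≤ 32 ^ p :=
            Real.rpow_le_rpow_of_exponent_le (by norm_num) (by linarith)
          gcongr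
      _ = _ := by
          rw [rpow_mul_coefA (by norm_num)]
          norm_num
  · unfold coefB
    split_ifs with h2
    · refine (mul_le_mul_of_nonneg_left (sum_mul_excess_rpow_le_of_lt_two hn hr (by linarith) h2 ht
        hx) (by positivity)).trans ?_
      have : (2 : ℝ) ^ (p - 1) ≤ 2 := rpow_le_self_of_one_le (by norm_num) (by linarith)
      calc _ ≤ 2 * (64 * (1 + (Real.log n / (1 + |2 - 2 * r - p| * Real.log n)) ^ (2 - p)
            * (1 + (n : ℝ) ^ (2 - 2 * r - p))) * t ^ (2 * (p - 1))) := by gcongr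
        _ ≤ _ := by
            rw [← mul_assoc, ← mul_assoc]
            gcongr
            norm_num
    · refine (mul_le_mul_of_nonneg_left (sum_mul_excess_rpow_le_of_two_le hr (not_lt.1 h2) ht
        hx) (by positivity)).trans ?_
      rw [← mul_assoc, ← Real.mul_rpow (by norm_num) (by norm_num)]
      gcongr
      calc ((2 : ℝ) * 16) ^ (p - 1) ≤ 256 ^ (p - 1) := by
            apply Real.rpow_le_rpow <;> linarith
        _ ≤ _ := Real.rpow_le_rpow_of_exponent_le (by norm_num) (by linarith)

lemma levelI_nonneg {C : ℝ} (hC : 0 ≤ C) {n : ℕ} (hn : 3 ≤ n) {r p t : ℝ} (hp : 1 ≤ p)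
    (ht : 0 < t) : 0 ≤ levelI C n r p t := by
  have hL := one_le_log hn
  have hA := coefA_nonneg hC hn (r := r) hp
  have hB : 0 ≤ coefB C n r p := by
    unfold coefB
    split_ifs <;> positivity
  unfold levelI
  positivity

lemma isNorm_normI {n : ℕ} {r p : ℝ} (hn : 1 ≤ n) (hr : 0 ≤ r) (hp : 3 / 2 ≤ p) :
    IsNorm (normI (n := n) r p) := by
  refine isNorm_rpow_sum hn (c := fun i => (i : ℝ) ^ (-2 * r)) (by linarith) ?_
    (fun i _ => by positivity) (by simp)
  intro i hi j _ hij
  exact Real.rpow_le_rpow_of_nonpos (by exact_mod_cast hi.1) (by exact_mod_cast hij) (by linarith)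

theorem caseI : ∃ C C₁ : ℝ, 0 < C ∧ 0 < C₁ ∧
      ∀ (n : ℕ) (r p t : ℝ), 3 ≤ n → 0 ≤ r → 3 / 2 ≤ p → 0 < t →
        ∀ R S : ℝ, R = levelI C₁ n r p t → S = R ^ (1 / (2 * (p - 1))) →
          S ^ (2 * (p - 1)) = R ∧
          IsNorm (normI (n := n) r p) ∧
          GaussianBound.{u} C t (normI (n := n) r p) S ∧
          ∀ x : E n, normI r p x ≤ S → lorentzSum r p x ≤ R := by
  refine ⟨4, 256, by norm_num, by norm_num, ?_⟩
  intro n r p t hn hr hp ht R S hR hS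
  have hR0 : 0 ≤ R := hR ▸ levelI_nonneg (by norm_num) hn (by linarith) ht
  have hq : 0 < 2 * (p - 1) := by linarith
  have hinv : ∀ u : ℝ, 0 ≤ u → (u ^ (1 / (2 * (p - 1)))) ^ (2 * (p - 1)) = u := by
    intro u hu
    rw [← Real.rpow_mul hu, one_div_mul_cancel hq.ne', Real.rpow_one]
  refine ⟨by rw [hS, hinv R hR0], isNorm_normI (by omega) hr hp, ?_, ?_⟩
  · refine gaussianBound_of_goodSet (by omega) fun x hx => ?_
    rw [normI, hS]
    refine Real.rpow_le_rpow (lorentzSum_nonneg r p x) ?_ (by positivity)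
    rw [hR]
    exact lorentzSum_le_levelI hn hr hp ht hx
  · intro x hx
    have h := Real.rpow_le_rpow (Real.rpow_nonneg (lorentzSum_nonneg r p x) _) hx hq.le
    rwa [hS, hinv R hR0, hinv _ (lorentzSum_nonneg r p x)] at h

/-! The norm with coefficients `i^{-2r} (ln (n/i) + t²/i)^{-(3-2p)/2}` -/

lemma antitoneOn_rpow_mul_ord_rpow {n : ℕ} {r q : ℝ} (hr : 0 ≤ r) (hq : 0 ≤ q) (x : E n) :
    AntitoneOn (fun i : ℕ => (i : ℝ) ^ (-2 * r) * ord x i ^ q) (Set.Icc 1 n) := by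
  intro i hi j hj hij
  have hi0 : (0 : ℝ) < i := by exact_mod_cast hi.1
  refine mul_le_mul ?_ ?_ (Real.rpow_nonneg (ord_nonneg x j) _) (by positivity)
  · exact Real.rpow_le_rpow_of_nonpos hi0 (by exact_mod_cast hij) (by linarith)
  · exact Real.rpow_le_rpow (ord_nonneg x j) (ord_antitoneOn x hi hj hij) hq

lemma lorentzSum_le_six_mul {n : ℕ} (hn : 3 ≤ n) {r p : ℝ} (hr : 0 ≤ r) (hp : 1 ≤ p) (x : E n) :
    lorentzSum r p x ≤ 6 * ∑ i ∈ idx n, (i : ℝ) ^ (-2 * r) * ord x i ^ (2 * (p - 1)) :=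
  sum_le_six_mul_sum_idx hn (antitoneOn_rpow_mul_ord_rpow hr (by linarith) x)
    fun i _ => mul_nonneg (by positivity) (Real.rpow_nonneg (ord_nonneg x i) _)

/-- Hölder's inequality for a factorization `i^{-2r} = a_i^{2(p-1)} b_i^{3-2p}` of the weights. -/
lemma lorentzSum_le_of_factor {n : ℕ} (hn : 3 ≤ n) {r p : ℝ} (hr : 0 ≤ r) (hp : 1 ≤ p)
    (hp2 : p < 3 / 2) {a b : ℕ → ℝ} (ha : ∀ i ∈ idx n, 0 ≤ a i) (hb : ∀ i ∈ idx n, 0 ≤ b i)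
    (hab : ∀ i ∈ idx n, a i ^ (2 * (p - 1)) * b i ^ (3 - 2 * p) = (i : ℝ) ^ (-2 * r)) (x : E n) :
    lorentzSum r p x ≤ 6 * ((∑ i ∈ idx n, b i) ^ (3 - 2 * p)
      * (∑ i ∈ idx n, a i * ord x i) ^ (2 * (p - 1))) := by
  refine (lorentzSum_le_six_mul hn hr hp x).trans ?_
  have h := sum_rpow_mul_rpow_le (idx n) (A := fun i => a i * ord x i) (B := b)
    (θ := 2 * (p - 1)) (by linarith) (by linarith)
    (fun i hi => mul_nonneg (ha i hi) (ord_nonneg x i)) hb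
  rw [show 1 - 2 * (p - 1) = 3 - 2 * p by ring] at h
  gcongr
  rw [mul_comm (_ ^ (3 - 2 * p))]
  refine le_trans (le_of_eq (Finset.sum_congr rfl fun i hi => ?_)) h
  rw [← hab i hi, Real.mul_rpow (ha i hi) (ord_nonneg x i)]
  ring

lemma one_le_log_div_add {n i : ℕ} (t : ℝ) (hi : i ∈ idx n) :
    1 ≤ Real.log (n / i) + t ^ 2 / i := by
  have := one_le_log_div hi
  have : 0 ≤ t ^ 2 / (i : ℝ) := by positivity
  linarith

lemma pos_of_mem_idx {n i : ℕ} (hi : i ∈ idx n) : (0 : ℝ) < i := by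
  exact_mod_cast (mem_idx.1 hi).1

lemma sumII_nonneg (n : ℕ) (r p t : ℝ) : 0 ≤ sumII n r p t := by
  refine Finset.sum_nonneg fun i hi => ?_
  have := one_le_log_div_add t hi
  positivity

lemma normII_nonneg {n : ℕ} (r p t : ℝ) (x : E n) : 0 ≤ normII r p t x := by
  refine Finset.sum_nonneg fun i hi => ?_
  have := one_le_log_div_add t hi
  have := ord_nonneg x i
  positivity

/-- Put v_i = ln(n/i) + t²/i, the order of x_[i]² on the good event. Then b_i = i^{-2r} v_i^{p-1}
has the size of the i-th summand and a_i = b_i v_i^{-1/2}, so a_i x_[i] is of order b_i and Hölder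
loses only a constant there. -/
lemma lorentzSum_le_normII {n : ℕ} (hn : 3 ≤ n) {r p : ℝ} (hr : 0 ≤ r) (hp : 1 ≤ p)
    (hp2 : p < 3 / 2) (t : ℝ) (x : E n) :
    lorentzSum r p x ≤ 6 * sumII n r p t ^ (3 - 2 * p) * normII r p t x ^ (2 * (p - 1)) := by
  rw [mul_assoc]
  refine (lorentzSum_le_of_factor hn hr hp hp2
    (a := fun i => (i : ℝ) ^ (-2 * r) / (Real.log (n / i) + t ^ 2 / i) ^ ((3 - 2 * p) / 2))
    (b := fun i => (i : ℝ) ^ (-2 * r) * (Real.log (n / i) + t ^ 2 / i) ^ (p - 1))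
    ?_ ?_ ?_ x).trans_eq ?_
  · intro i hi
    have := one_le_log_div_add t hi
    positivity
  · intro i hi
    have := one_le_log_div_add t hi
    positivity
  · intro i hi
    have hv := one_le_log_div_add t hi
    have hi0 := pos_of_mem_idx hi
    set v := Real.log (n / i) + t ^ 2 / i
    have hv0 : 0 < v := by linarith
    rw [div_eq_mul_inv, ← Real.rpow_neg hv0.le, Real.mul_rpow (by positivity) (by positivity),
      Real.mul_rpow (by positivity) (by positivity), mul_mul_mul_comm, ← Real.rpow_mul hi0.le,
      ← Real.rpow_mul hi0.le, ← Real.rpow_mul hv0.le, ← Real.rpow_mul hv0.le,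
      ← Real.rpow_add hi0, ← Real.rpow_add hv0]
    rw [show -((3 - 2 * p) / 2) * (2 * (p - 1)) + (p - 1) * (3 - 2 * p) = 0 by ring,
      Real.rpow_zero, mul_one]
    congr 1
    ring
  · simp only [sumII, normII]
    congr 3
    exact Finset.sum_congr rfl fun i _ => by ring

lemma normII_le_of_mem_goodSet {n : ℕ} {r p t : ℝ} {x : E n} (hx : x ∈ goodSet n t) :
    normII r p t x ≤ 4 * sumII n r p t := by
  rw [normII, sumII, Finset.mul_sum]
  refine Finset.sum_le_sum fun i hi => ?_
  have hv := one_le_log_div_add t hi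
  have hl := one_le_log_div hi
  have hmem := Finset.mem_Icc.1 (idx_subset n hi)
  have hord := ord_sq_le_of_mem_goodSet hx hmem.1 hmem.2
  have ht2 : 0 ≤ t ^ 2 / (i : ℝ) := by positivity
  obtain ⟨v, hv'⟩ : ∃ v, v = Real.log (n / i) + t ^ 2 / i := ⟨_, rfl⟩
  rw [← hv'] at hv ⊢
  have hv0 : 0 < v := by linarith
  -- The restriction i ≤ n/e gives v ≥ 1, so 8(1 + v) ≤ 16v.
  have h1 : ord x i ≤ 4 * v ^ (1 / 2 : ℝ) := by
    rw [← Real.sqrt_eq_rpow]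
    refine (pow_le_pow_iff_left₀ (ord_nonneg x i) (by positivity) (two_ne_zero)).1 ?_
    rw [mul_pow, Real.sq_sqrt hv0.le]
    linarith
  calc (i : ℝ) ^ (-2 * r) * ord x i / v ^ ((3 - 2 * p) / 2)
      ≤ (i : ℝ) ^ (-2 * r) * (4 * v ^ (1 / 2 : ℝ)) / v ^ ((3 - 2 * p) / 2) := by gcongr
    _ = 4 * ((i : ℝ) ^ (-2 * r) * (v ^ (1 / 2 : ℝ) / v ^ ((3 - 2 * p) / 2))) := by ring
    _ = _ := by
        rw [← Real.rpow_sub hv0]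
        congr 3
        ring

lemma coefA_le_of_le_three_half {n : ℕ} (hn : 3 ≤ n) {r p : ℝ} (hp : 1 ≤ p) (hp2 : p < 3 / 2) :
    coefA 8 n r p ≤ 144 * (if r ≤ 1 / 2 then
      (n : ℝ) ^ (1 - 2 * r) * Real.log n ^ p / (1 + (1 - 2 * r) * Real.log n) ^ p
    else
      (Real.log n ^ p / (1 + (2 * r - 1) * Real.log n) + Real.log n ^ (p - 1))) := by
  have hL := one_le_log hn
  have h12 : (12 : ℝ) ^ p ≤ 144 := by
    calc (12 : ℝ) ^ p ≤ 12 ^ (2 : ℝ) :=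
          Real.rpow_le_rpow_of_exponent_le (by norm_num) (by linarith)
      _ = 144 := by norm_num
  unfold coefA
  split_ifs with h
  · have ha : 0 ≤ 1 - 2 * r := by linarith
    calc (8 : ℝ) ^ p * p ^ p * (n : ℝ) ^ (1 - 2 * r) * Real.log n ^ p
          / (p + (1 - 2 * r) * Real.log n) ^ p
        ≤ 144 * (n : ℝ) ^ (1 - 2 * r) * Real.log n ^ p / (1 + (1 - 2 * r) * Real.log n) ^ p := by
          have : (8 : ℝ) ^ p * p ^ p ≤ 144 := by
            refine le_trans ?_ h12
            rw [← Real.mul_rpow (by norm_num) (by linarith)]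
            exact Real.rpow_le_rpow (by positivity) (by linarith) (by linarith)
          gcongr
      _ = _ := by ring
  · have ha : 0 ≤ 2 * r - 1 := by linarith
    have h8 : (8 : ℝ) ^ p ≤ 144 :=
      (Real.rpow_le_rpow (by norm_num) (by norm_num) (by linarith)).trans h12
    rw [mul_div_assoc, ← mul_add]
    gcongr

/-- Subadditivity of u^{p-1} separates the logarithmic profile from t^{2(p-1)} ∑ i^{-2r-(p-1)}. -/
lemma sumII_le_boundII {n : ℕ} (hn : 3 ≤ n) {r p t : ℝ} (hr : 0 ≤ r) (hp : 1 ≤ p)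
    (hp2 : p < 3 / 2) (ht : 0 < t) : sumII n r p t ≤ boundII 144 n r p t := by
  have hL := one_le_log hn
  have h1 : sumII n r p t ≤ logSum n r p
      + t ^ (2 * (p - 1)) * ∑ i ∈ Finset.Icc 1 n, (i : ℝ) ^ (2 - 2 * r - p - 1) := by
    rw [logSum, Finset.mul_sum, ← Finset.sum_add_distrib, sumII]
    have hterm : ∀ i ∈ Finset.Icc 1 n, 0 ≤ Real.log ((n : ℝ) / i) := fun i hi => by
      rw [Finset.mem_Icc] at hi
      linarith [one_le_one_add_log_div hi.1 hi.2]
    refine (Finset.sum_le_sum_of_subset_of_nonneg (idx_subset n) fun i hi _ => ?_).trans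
      (Finset.sum_le_sum fun i hi => ?_)
    · have := hterm i hi
      positivity
    · have hlog := hterm i hi
      rw [Finset.mem_Icc] at hi
      have hi0 : (0 : ℝ) < i := by exact_mod_cast hi.1
      calc (i : ℝ) ^ (-2 * r) * (Real.log (n / i) + t ^ 2 / i) ^ (p - 1)
          ≤ (i : ℝ) ^ (-2 * r) * ((1 + Real.log (n / i)) ^ (p - 1) + (t ^ 2 / i) ^ (p - 1)) := by
            gcongr
            refine (Real.rpow_add_le_add_rpow hlog (by positivity) (by linarith)
              (by linarith)).trans ?_
            gcongr
            linarith
        _ = (i : ℝ) ^ (-2 * r) * (1 + Real.log (n / i)) ^ (p - 1)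
            + t ^ (2 * (p - 1)) * ((i : ℝ) ^ (-2 * r) * (i : ℝ) ^ (-(p - 1))) := by
            rw [rpow_two_mul ht.le, Real.div_rpow (by positivity) hi0.le, Real.rpow_neg hi0.le]
            ring
        _ = _ := by
            rw [← Real.rpow_add hi0]
            congr 3
            ring
  refine h1.trans ?_
  unfold boundII
  refine add_le_add ?_ ?_
  · refine (logSum_le_coefA hn hr hp).trans ((coefA_le_of_le_three_half hn hp hp2).trans_eq ?_)
    split_ifs <;> ring
  · rw [mul_comm]
    gcongr
    refine (sum_rpow_le (by linarith) hn).trans ?_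
    have : 0 ≤ (1 + (n : ℝ) ^ (2 - 2 * r - p)) / (1 + |2 - 2 * r - p| * Real.log n)
        * Real.log n := by positivity
    rw [mul_assoc, ← mul_div_assoc, mul_div_right_comm]
    linarith

/-- The function u ln(n/u) increases up to u = n/e, which is what makes the coefficients of Cases II
and IVa monotone on that range. -/
lemma mul_log_div_monotone {n i j : ℕ} (hj : j ∈ idx n) (hi : 1 ≤ i) (hij : i ≤ j) :
    (i : ℝ) * Real.log (n / i) ≤ j * Real.log (n / j) := by
  have hi0 : (0 : ℝ) < i := by exact_mod_cast hi
  have hj0 := pos_of_mem_idx hj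
  have hl := one_le_log_div hj
  have hij' : (i : ℝ) ≤ j := by exact_mod_cast hij
  have hn0 : (0 : ℝ) < n := by
    have := (Finset.mem_Icc.1 (idx_subset n hj))
    exact_mod_cast (by omega : 0 < n)
  have h1 : Real.log ((n : ℝ) / i) = Real.log (n / j) + Real.log (j / i) := by
    rw [← Real.log_mul (by positivity) (by positivity)]
    congr 1
    field_simp
  have h2 : Real.log ((j : ℝ) / i) ≤ j / i - 1 := Real.log_le_sub_one_of_pos (by positivity)
  have h3 : (i : ℝ) * Real.log (j / i) ≤ j - i := by
    calc (i : ℝ) * Real.log (j / i) ≤ i * (j / i - 1) := by gcongr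
      _ = _ := by field_simp
  rw [h1]
  nlinarith

/-- Clearing the denominator i writes each coefficient as i^{-2r+(3-2p)/2} (i ln(n/i) +
t²)^{-(3-2p)/2}. The second factor is always non-increasing; the first is exactly when p ≥ 3/2 - 2r.
-/
lemma isNorm_normII {n : ℕ} (hn : 3 ≤ n) {r p t : ℝ} (hp2 : p < 3 / 2)
    (hpr : 3 / 2 - 2 * r ≤ p) : IsNorm (normII (n := n) r p t) := by
  have h := isNorm_sum_idx hn (c := fun i : ℕ => (i : ℝ) ^ (-2 * r + (3 - 2 * p) / 2)
    * (i * Real.log (n / i) + t ^ 2) ^ (-((3 - 2 * p) / 2))) ?_ ?_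
  · convert h using 2 with x
    unfold normII
    refine Finset.sum_congr rfl fun i hi => ?_
    have hi0 := pos_of_mem_idx hi
    have hv := one_le_log_div_add t hi
    rw [show i * Real.log (n / i) + t ^ 2 = i * (Real.log (n / i) + t ^ 2 / i) by field_simp,
      Real.mul_rpow hi0.le (by linarith), ← mul_assoc, ← Real.rpow_add hi0,
      Real.rpow_neg (by linarith)]
    ring_nf
  · intro i hi j hj hij
    have hi0 := pos_of_mem_idx hi
    have hl := one_le_log_div hi
    refine mul_le_mul ?_ ?_ ?_ (by positivity)
    · exact Real.rpow_le_rpow_of_nonpos hi0 (by exact_mod_cast hij) (by linarith)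
    · refine Real.rpow_le_rpow_of_nonpos (by positivity) ?_ (by linarith)
      linarith [mul_log_div_monotone hj (mem_idx.1 hi).1 hij]
    · have := one_le_log_div hj
      positivity
  · intro i hi
    have := one_le_log_div hi
    have hi0 := pos_of_mem_idx hi
    positivity

lemma mul_boundII (c C : ℝ) (n : ℕ) (r p t : ℝ) :
    c * boundII C n r p t = boundII (c * C) n r p t := by
  unfold boundII
  split_ifs <;> ring

theorem caseII : ∃ C C₁ C₂ C₃ C₄ : ℝ, 0 < C ∧ 0 < C₁ ∧ 0 < C₂ ∧ 0 < C₃ ∧ 0 < C₄ ∧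
      ∀ (n : ℕ) (r p t : ℝ), 3 ≤ n → 0 ≤ r → 1 ≤ p → p < 3 / 2 → 0 < t →
        ∀ R S : ℝ, S = C₂ * sumII n r p t → R = C₃ * sumII n r p t →
          (3 / 2 - 2 * r ≤ p → IsNorm (normII (n := n) r p t)) ∧
          (∀ x : E n, lorentzSum r p x ≤
            C₁ * sumII n r p t ^ (3 - 2 * p) * normII r p t x ^ (2 * (p - 1))) ∧
          S ≤ boundII C₄ n r p t ∧
          R ≤ boundII C₄ n r p t ∧
          GaussianBound.{u} C t (normII (n := n) r p t) S ∧
          ∀ x : E n, normII r p t x ≤ S → lorentzSum r p x ≤ R := by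
  refine ⟨4, 6, 4, 24, 24 * 144, by norm_num, by norm_num, by norm_num, by norm_num, by norm_num, ?_⟩
  intro n r p t hn hr hp hp2 ht R S hS hR
  have hs0 := sumII_nonneg n r p t
  have hRb : R ≤ boundII (24 * 144) n r p t := by
    rw [hR, ← mul_boundII]
    have := sumII_le_boundII hn hr hp hp2 ht
    gcongr
  refine ⟨isNorm_normII hn hp2, lorentzSum_le_normII hn hr hp hp2 t, ?_, hRb, ?_, ?_⟩
  · exact le_trans (by rw [hS, hR]; linarith) hRb
  · refine gaussianBound_of_goodSet (by omega) fun x hx => ?_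
    rw [hS]
    exact normII_le_of_mem_goodSet hx
  · intro x hx
    refine (lorentzSum_le_normII hn hr hp hp2 t x).trans ?_
    rw [hS] at hx
    -- The exponents 3-2p and 2(p-1) add up to 1, so the result is linear in `sumII`, with 6 ·
    -- 4^{2(p-1)} ≤ 24.
    calc 6 * sumII n r p t ^ (3 - 2 * p) * normII r p t x ^ (2 * (p - 1))
        ≤ 6 * sumII n r p t ^ (3 - 2 * p) * (4 * sumII n r p t) ^ (2 * (p - 1)) := by
          have := normII_nonneg r p t x
          gcongr
      _ = 6 * (4 ^ (2 * (p - 1)) * (sumII n r p t ^ (3 - 2 * p)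
          * sumII n r p t ^ (2 * (p - 1)))) := by
          rw [Real.mul_rpow (by norm_num) hs0]
          ring
      _ ≤ 6 * (4 * sumII n r p t) := by
          rw [← Real.rpow_add_of_nonneg hs0 (by linarith) (by linarith),
            show 3 - 2 * p + 2 * (p - 1) = 1 by ring, Real.rpow_one]
          have : (4 : ℝ) ^ (2 * (p - 1)) ≤ 4 := rpow_le_self_of_one_le (by norm_num) (by linarith)
          gcongr
      _ = R := by rw [hR]; ring

/-! The norm with coefficients `i^{-2r}`, `r < 1/4` -/

lemma ord_le_add_sqrt_excess {n : ℕ} (x : E n) {i : ℕ} (hi : 1 ≤ i) (hin : i ≤ n) :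
    ord x i ≤ 4 * (1 + Real.log (n / i)) ^ (1 / 2 : ℝ) + excess x i ^ (1 / 2 : ℝ) := by
  have h1 := one_le_one_add_log_div hi hin
  have hw := excess_nonneg x i
  rw [← Real.sqrt_eq_rpow, ← Real.sqrt_eq_rpow]
  refine (pow_le_pow_iff_left₀ (ord_nonneg x i) (by positivity) two_ne_zero).1 ?_
  have h2 : √(1 + Real.log (n / i)) ^ 2 = _ := Real.sq_sqrt (by linarith)
  have h3 : √(excess x i) ^ 2 = _ := Real.sq_sqrt hw
  have h4 : 0 ≤ √(1 + Real.log (n / i)) * √(excess x i) := by positivity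
  nlinarith [ord_sq_le_add_excess x i]

/-- Cauchy–Schwarz against the total excess 16t², for norms linear in the order statistics. -/
lemma sum_mul_sqrt_excess_le {n : ℕ} {t : ℝ} (ht : 0 < t) {x : E n} (hx : x ∈ goodSet n t) {c M : ℝ}
    (hM : ∑ i ∈ Finset.Icc 1 n, (i : ℝ) ^ (2 * c) ≤ M) :
    ∑ i ∈ Finset.Icc 1 n, (i : ℝ) ^ c * excess x i ^ (1 / 2 : ℝ) ≤ M ^ (1 / 2 : ℝ) * (4 * t) := by
  have hM0 : 0 ≤ ∑ i ∈ Finset.Icc 1 n, (i : ℝ) ^ (2 * c) :=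
    Finset.sum_nonneg fun i _ => by positivity
  have h := sum_rpow_mul_rpow_le (Finset.Icc 1 n) (A := fun i : ℕ => (i : ℝ) ^ (2 * c))
    (B := excess x) (θ := 1 / 2) (by norm_num) (by norm_num) (fun i _ => by positivity)
    (fun i _ => excess_nonneg x i)
  rw [show (1 : ℝ) - 1 / 2 = 1 / 2 by norm_num] at h
  calc ∑ i ∈ Finset.Icc 1 n, (i : ℝ) ^ c * excess x i ^ (1 / 2 : ℝ)
      = ∑ i ∈ Finset.Icc 1 n, ((i : ℝ) ^ (2 * c)) ^ (1 / 2 : ℝ) * excess x i ^ (1 / 2 : ℝ) := by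
        refine Finset.sum_congr rfl fun i _ => ?_
        rw [← Real.rpow_mul (by positivity)]
        congr 2
        ring
    _ ≤ M ^ (1 / 2 : ℝ) * (16 * t ^ 2) ^ (1 / 2 : ℝ) := by
        refine h.trans (mul_le_mul ?_ ?_ ?_ ?_)
        · exact Real.rpow_le_rpow hM0 hM (by norm_num)
        · exact Real.rpow_le_rpow (Finset.sum_nonneg fun i _ => excess_nonneg x i)
            (sum_excess_le hx) (by norm_num)
        · exact Real.rpow_nonneg (Finset.sum_nonneg fun i _ => excess_nonneg x i) _
        · exact Real.rpow_nonneg (hM0.trans hM) _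
    _ = _ := by
        rw [← Real.sqrt_eq_rpow (16 * t ^ 2), show 16 * t ^ 2 = (4 * t) ^ 2 by ring,
          Real.sqrt_sq (by positivity)]

lemma normIII_nonneg {n : ℕ} (r : ℝ) (x : E n) : 0 ≤ normIII r x :=
  Finset.sum_nonneg fun i _ => mul_nonneg (by positivity) (ord_nonneg x i)

lemma normIII_le_of_mem_goodSet {n : ℕ} (hn : 3 ≤ n) {r t : ℝ} (hr : 0 ≤ r) (hr4 : r < 1 / 4)
    (ht : 0 < t) {x : E n} (hx : x ∈ goodSet n t) : normIII r x ≤ levelIII 576 n r t := by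
  have hL := one_le_log hn
  have hn0 : (0 : ℝ) < n := by positivity
  have ha : 0 < 1 - 4 * r := by linarith
  -- The parameter 3/2 makes the profile exponent 1/2: the norm is linear in x_[i], hence sees the
  -- square root of ln(en/i).
  have h1 : normIII r x ≤ 4 * logSum n r (3 / 2)
      + ∑ i ∈ Finset.Icc 1 n, (i : ℝ) ^ (-2 * r) * excess x i ^ (1 / 2 : ℝ) := by
    rw [logSum, Finset.mul_sum, ← Finset.sum_add_distrib, normIII]
    refine Finset.sum_le_sum fun i hi => ?_
    rw [Finset.mem_Icc] at hi
    rw [show (3 / 2 - 1 : ℝ) = 1 / 2 by norm_num]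
    calc (i : ℝ) ^ (-2 * r) * ord x i ≤ (i : ℝ) ^ (-2 * r) *
          (4 * (1 + Real.log (n / i)) ^ (1 / 2 : ℝ) + excess x i ^ (1 / 2 : ℝ)) := by
          gcongr
          exact ord_le_add_sqrt_excess x hi.1 hi.2
      _ = _ := by ring
  have h2 : logSum n r (3 / 2) ≤ 144 * (n : ℝ) ^ (1 - 2 * r) := by
    refine (logSum_le_of_pos hn hr (by linarith) (by norm_num)).trans ?_
    gcongr
    have hbase : 4 * (3 / 2) / (1 - 2 * r) ≤ 12 := by
      rw [div_le_iff₀ (by linarith)]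
      linarith
    have ha2 : 0 < 1 - 2 * r := by linarith
    calc (4 * (3 / 2) / (1 - 2 * r)) ^ (3 / 2 : ℝ) ≤ 12 ^ (3 / 2 : ℝ) := by gcongr
      _ ≤ 12 ^ (2 : ℝ) := Real.rpow_le_rpow_of_exponent_le (by norm_num) (by norm_num)
      _ = 144 := by norm_num
  have h3 := sum_mul_sqrt_excess_le ht hx (c := -2 * r)
    (M := 4 * (n : ℝ) ^ (1 - 4 * r) * (Real.log n / (1 + (1 - 4 * r) * Real.log n))) (by
      rw [show 2 * (-2 * r) = (1 - 4 * r) - 1 by ring]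
      exact sum_rpow_le_of_nonneg ha.le (by linarith) hn)
  have h4 : (4 * (n : ℝ) ^ (1 - 4 * r) * (Real.log n / (1 + (1 - 4 * r) * Real.log n)))
      ^ (1 / 2 : ℝ) = 2 * (n : ℝ) ^ ((1 - 4 * r) / 2)
        * (Real.log n / (1 + (1 - 4 * r) * Real.log n)) ^ (1 / 2 : ℝ) := by
    rw [Real.mul_rpow (by positivity) (by positivity), Real.mul_rpow (by norm_num) (by positivity),
      ← Real.rpow_mul hn0.le, ← Real.sqrt_eq_rpow 4, show (4 : ℝ) = 2 ^ 2 by norm_num,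
      Real.sqrt_sq (by norm_num)]
    congr 3
    ring
  rw [h4] at h3
  have h5 : 0 ≤ (n : ℝ) ^ ((1 - 4 * r) / 2)
      * (Real.log n / (1 + (1 - 4 * r) * Real.log n)) ^ (1 / 2 : ℝ) * t := by positivity
  unfold levelIII
  linarith

/-- Hölder with i^{-2r} in both factors; r < 1/4 gives ∑ i^{-2r} ≤ n^{1-2r}/(1-2r) ≤ 2n^{1-2r}. -/
lemma lorentzSum_le_normIII {n : ℕ} (hn : 3 ≤ n) {r p : ℝ} (hr : 0 ≤ r) (hr4 : r < 1 / 4)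
    (hp : 1 ≤ p) (hp2 : p < 3 / 2) (x : E n) :
    lorentzSum r p x ≤ 2 * (n : ℝ) ^ ((1 - 2 * r) * (3 - 2 * p))
      * normIII r x ^ (2 * (p - 1)) := by
  have hn0 : (0 : ℝ) < n := by positivity
  have h := sum_rpow_mul_rpow_le (Finset.Icc 1 n)
    (A := fun i : ℕ => (i : ℝ) ^ (-2 * r) * ord x i) (B := fun i : ℕ => (i : ℝ) ^ (-2 * r))
    (θ := 2 * (p - 1)) (by linarith) (by linarith)
    (fun i _ => mul_nonneg (by positivity) (ord_nonneg x i)) (fun i _ => by positivity)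
  rw [show 1 - 2 * (p - 1) = 3 - 2 * p by ring] at h
  have hsum : ∑ i ∈ Finset.Icc 1 n, (i : ℝ) ^ (-2 * r) ≤ 2 * (n : ℝ) ^ (1 - 2 * r) := by
    rw [show -2 * r = (1 - 2 * r) - 1 by ring]
    refine (sum_rpow_sub_one_le (by linarith) (by linarith) n).trans ?_
    rw [div_le_iff₀ (by linarith)]
    nlinarith [Real.rpow_nonneg hn0.le (1 - 2 * r)]
  calc lorentzSum r p x = ∑ i ∈ Finset.Icc 1 n,
        ((i : ℝ) ^ (-2 * r) * ord x i) ^ (2 * (p - 1)) * ((i : ℝ) ^ (-2 * r)) ^ (3 - 2 * p) := by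
        refine Finset.sum_congr rfl fun i hi => ?_
        have hi0 : (0 : ℝ) < i := by exact_mod_cast (Finset.mem_Icc.1 hi).1
        rw [Real.mul_rpow (by positivity) (ord_nonneg x i), mul_right_comm,
          ← Real.rpow_add (by positivity), show 2 * (p - 1) + (3 - 2 * p) = 1 by ring,
          Real.rpow_one]
    _ ≤ normIII r x ^ (2 * (p - 1)) * (2 * (n : ℝ) ^ (1 - 2 * r)) ^ (3 - 2 * p) := by
        refine h.trans (mul_le_mul_of_nonneg_left ?_ (Real.rpow_nonneg (normIII_nonneg r x) _))
        exact Real.rpow_le_rpow (Finset.sum_nonneg fun i _ => by positivity) hsum (by linarith)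
    _ ≤ normIII r x ^ (2 * (p - 1)) * (2 * (n : ℝ) ^ ((1 - 2 * r) * (3 - 2 * p))) := by
        rw [Real.mul_rpow (by norm_num) (by positivity), ← Real.rpow_mul hn0.le]
        have := normIII_nonneg r x
        have : (2 : ℝ) ^ (3 - 2 * p) ≤ 2 := rpow_le_self_of_one_le (by norm_num) (by linarith)
        gcongr
    _ = _ := by ring

lemma levelIII_rpow_le {n : ℕ} (hn : 3 ≤ n) {r p t : ℝ} (hr4 : r < 1 / 4)
    (hp : 1 ≤ p) (hp2 : p < 3 / 2) (ht : 0 < t) :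
    2 * (n : ℝ) ^ ((1 - 2 * r) * (3 - 2 * p)) * levelIII 576 n r t ^ (2 * (p - 1))
      ≤ boundIII 1152 n r p t := by
  have hL := one_le_log hn
  have hn0 : (0 : ℝ) < n := by positivity
  have ha : 0 < 1 - 4 * r := by linarith
  obtain ⟨Q, hQ⟩ : ∃ Q, Q = Real.log n / (1 + (1 - 4 * r) * Real.log n) := ⟨_, rfl⟩
  have hQ0 : 0 ≤ Q := by rw [hQ]; positivity
  unfold levelIII boundIII
  rw [← hQ]
  have h576 : (576 : ℝ) ^ (2 * (p - 1)) ≤ 576 := rpow_le_self_of_one_le (by norm_num) (by linarith)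
  have hS : (576 * (n : ℝ) ^ (1 - 2 * r) + 576 * (n : ℝ) ^ ((1 - 4 * r) / 2) * Q ^ (1 / 2 : ℝ) * t)
      ^ (2 * (p - 1)) ≤ 576 * ((n : ℝ) ^ ((1 - 2 * r) * (2 * (p - 1)))
        + (n : ℝ) ^ ((1 - 4 * r) / 2 * (2 * (p - 1))) * Q ^ (p - 1) * t ^ (2 * (p - 1))) := by
    refine (Real.rpow_add_le_add_rpow (by positivity) (by positivity) (by linarith)
      (by linarith)).trans ?_
    rw [Real.mul_rpow (by positivity) (by positivity), Real.mul_rpow (by positivity) ht.le,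
      Real.mul_rpow (by positivity) (by positivity), Real.mul_rpow (by positivity) (by positivity),
      ← Real.rpow_mul hn0.le, ← Real.rpow_mul hn0.le, ← Real.rpow_mul hQ0,
      show 1 / 2 * (2 * (p - 1)) = p - 1 by ring, mul_assoc (576 ^ _ : ℝ), mul_assoc (576 ^ _ : ℝ),
      ← mul_add]
    gcongr
  calc _ ≤ 2 * (n : ℝ) ^ ((1 - 2 * r) * (3 - 2 * p)) *
        (576 * ((n : ℝ) ^ ((1 - 2 * r) * (2 * (p - 1)))
        + (n : ℝ) ^ ((1 - 4 * r) / 2 * (2 * (p - 1))) * Q ^ (p - 1) * t ^ (2 * (p - 1)))) := by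
        gcongr
    _ = 1152 * ((n : ℝ) ^ ((1 - 2 * r) * (3 - 2 * p)) * (n : ℝ) ^ ((1 - 2 * r) * (2 * (p - 1))))
        + 1152 * ((n : ℝ) ^ ((1 - 2 * r) * (3 - 2 * p))
          * (n : ℝ) ^ ((1 - 4 * r) / 2 * (2 * (p - 1)))) * Q ^ (p - 1) * t ^ (2 * (p - 1)) := by
        ring
    _ = _ := by
        rw [← Real.rpow_add hn0, ← Real.rpow_add hn0,
          show (1 - 2 * r) * (3 - 2 * p) + (1 - 2 * r) * (2 * (p - 1)) = 1 - 2 * r by ring,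
          show (1 - 2 * r) * (3 - 2 * p) + (1 - 4 * r) / 2 * (2 * (p - 1)) = 2 - 2 * r - p by ring]

theorem caseIII : ∃ C C₁ C₂ C₃ : ℝ, 0 < C ∧ 0 < C₁ ∧ 0 < C₂ ∧ 0 < C₃ ∧
      ∀ (n : ℕ) (r p t : ℝ), 3 ≤ n → 0 ≤ r → 1 ≤ p → p < 3 / 2 - 2 * r → 0 < t →
        ∀ R S : ℝ, S = levelIII C₂ n r t →
          R = C₁ * (n : ℝ) ^ ((1 - 2 * r) * (3 - 2 * p)) * S ^ (2 * (p - 1)) →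
          r < 1 / 4 ∧ p < 3 / 2 ∧
          IsNorm (normIII (n := n) r) ∧
          (∀ x : E n, lorentzSum r p x ≤
            C₁ * (n : ℝ) ^ ((1 - 2 * r) * (3 - 2 * p)) * normIII r x ^ (2 * (p - 1))) ∧
          R ≤ boundIII C₃ n r p t ∧
          GaussianBound.{u} C t (normIII (n := n) r) S ∧
          ∀ x : E n, normIII r x ≤ S → lorentzSum r p x ≤ R := by
  refine ⟨4, 2, 576, 1152, by norm_num, by norm_num, by norm_num, by norm_num, ?_⟩
  intro n r p t hn hr hp hpr ht R S hS hR
  have hr4 : r < 1 / 4 := by linarith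
  have hp2 : p < 3 / 2 := by linarith
  refine ⟨hr4, hp2, ?_, lorentzSum_le_normIII hn hr hr4 hp hp2, ?_, ?_, ?_⟩
  · refine isNorm_sum (by omega) (c := fun i : ℕ => (i : ℝ) ^ (-2 * r)) ?_
      (fun i _ => by positivity) (by simp)
    intro i hi j _ hij
    exact Real.rpow_le_rpow_of_nonpos (by exact_mod_cast hi.1) (by exact_mod_cast hij)
      (by linarith)
  · rw [hR, hS]
    exact levelIII_rpow_le hn hr4 hp hp2 ht
  · refine gaussianBound_of_goodSet (by omega) fun x hx => ?_
    rw [hS]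
    exact normIII_le_of_mem_goodSet hn hr hr4 ht hx
  · intro x hx
    refine (lorentzSum_le_normIII hn hr hr4 hp hp2 x).trans ?_
    rw [hR]
    have := normIII_nonneg r x
    gcongr

/-! The Euclidean norm -/

/-- At the critical exponent i^{-2r} = (1/i)^{2-p}, so Hölder with exponents p-1 and 2-p leaves the
Euclidean norm and the harmonic sum. -/
lemma lorentzSum_le_norm {n : ℕ} (hn : 3 ≤ n) {r p : ℝ} (hp : 1 ≤ p) (hp2 : p < 3 / 2)
    (hpr : p = 2 * (1 - r)) (x : E n) :
    lorentzSum r p x ≤ 2 * Real.log n * ‖x‖ ^ (2 * (p - 1)) := by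
  have hL := one_le_log hn
  have h := sum_rpow_mul_rpow_le (Finset.Icc 1 n) (A := fun i : ℕ => ord x i ^ 2)
    (B := fun i : ℕ => (i : ℝ)⁻¹) (θ := p - 1) (by linarith) (by linarith)
    (fun i _ => by positivity) (fun i _ => by positivity)
  rw [sum_ord_sq] at h
  calc lorentzSum r p x = ∑ i ∈ Finset.Icc 1 n,
        (ord x i ^ 2) ^ (p - 1) * ((i : ℝ)⁻¹) ^ (1 - (p - 1)) := by
        refine Finset.sum_congr rfl fun i _ => ?_
        rw [rpow_two_mul (ord_nonneg x i), mul_comm, Real.inv_rpow (by positivity),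
          ← Real.rpow_neg (by positivity)]
        congr 2
        linarith
    _ ≤ (‖x‖ ^ 2) ^ (p - 1) * (2 * Real.log n) ^ (1 - (p - 1)) := by
        refine h.trans (mul_le_mul_of_nonneg_left ?_ (by positivity))
        refine Real.rpow_le_rpow (Finset.sum_nonneg fun i _ => by positivity) ?_ (by linarith)
        linarith [sum_inv_le n]
    _ ≤ (‖x‖ ^ 2) ^ (p - 1) * (2 * Real.log n) := by
        have := rpow_le_self_of_one_le (c := 2 * Real.log n) (q := 1 - (p - 1)) (by linarith)
          (by linarith)
        gcongr
    _ = _ := by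
        rw [rpow_two_mul (norm_nonneg x)]
        ring

theorem caseIVb : ∃ C C₁ C₂ C₃ : ℝ, 0 < C ∧ 0 < C₁ ∧ 0 < C₂ ∧ 0 < C₃ ∧
      ∀ (n : ℕ) (r p t : ℝ), 3 ≤ n → 1 / 4 < r → r ≤ 1 / 2 → p = 2 * (1 - r) → 0 < t →
        (1 - 2 * r) * Real.log n < Real.exp 1 →
        ∀ R S : ℝ, S = C₂ * (n : ℝ) ^ (1 / 2 : ℝ) + t →
          R = C₁ * Real.log n * S ^ (2 * (p - 1)) →
          1 ≤ p ∧ p < 3 / 2 ∧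
          IsNorm (fun x : E n => ‖x‖) ∧
          (∀ x : E n, lorentzSum r p x ≤ C₁ * Real.log n * ‖x‖ ^ (2 * (p - 1))) ∧
          R ≤ C₃ * Real.log n * max 1 t ^ (2 * (p - 1)) ∧
          GaussianBound.{u} C t (fun x : E n => ‖x‖) S ∧
          ∀ x : E n, ‖x‖ ≤ S → lorentzSum r p x ≤ R := by
  refine ⟨1, 2, 1, 2 * (Real.exp (Real.exp 1) + 1), by norm_num, by norm_num, by norm_num,
    by positivity, ?_⟩
  intro n r p t hn hr4 hr2 hpr ht hsmall R S hS hR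
  have hL := one_le_log hn
  have hn0 : (0 : ℝ) < n := by positivity
  have hp : 1 ≤ p := by linarith
  have hp2 : p < 3 / 2 := by linarith
  refine ⟨hp, hp2, ⟨normSeminorm ℝ (E n), fun x => rfl, fun x hx => norm_eq_zero.1 hx⟩,
    lorentzSum_le_norm hn hp hp2 hpr, ?_, ?_, ?_⟩
  · have h1 : S ^ (2 * (p - 1)) ≤ Real.exp (Real.exp 1) + t ^ (2 * (p - 1)) := by
      rw [hS, one_mul]
      refine (Real.rpow_add_le_add_rpow (by positivity) ht.le (by linarith) (by linarith)).trans ?_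
      gcongr
      -- As p - 1 = 1 - 2r, the term is n^{1-2r} = exp((1-2r) ln n), bounded by e^e in this subcase.
      rw [← Real.rpow_mul hn0.le, Real.rpow_def_of_pos hn0]
      apply Real.exp_le_exp.2
      refine le_trans (le_of_eq ?_) hsmall.le
      rw [hpr]
      ring
    have hm : 1 ≤ max 1 t ^ (2 * (p - 1)) :=
      Real.one_le_rpow (le_max_left _ _) (by linarith)
    have ht' : t ^ (2 * (p - 1)) ≤ max 1 t ^ (2 * (p - 1)) :=
      Real.rpow_le_rpow ht.le (le_max_right _ _) (by linarith)
    have h2 : S ^ (2 * (p - 1)) ≤ (Real.exp (Real.exp 1) + 1) * max 1 t ^ (2 * (p - 1)) := by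
      have := Real.exp_pos (Real.exp 1)
      nlinarith
    calc R ≤ 2 * Real.log n * ((Real.exp (Real.exp 1) + 1) * max 1 t ^ (2 * (p - 1))) := by
          rw [hR]
          gcongr
      _ = _ := by ring
  · rw [hS, one_mul]
    exact gaussianBound_norm (by omega) ht
  · intro x hx
    refine (lorentzSum_le_norm hn hp hp2 hpr x).trans ?_
    rw [hR]
    gcongr

/-! The norm with coefficients `β_i^{-(3-2p)/(2(p-1))} i^{-r/(p-1)}` -/

section

variable {n : ℕ} {r p : ℝ}

lemma one_sub_two_mul_eq (hpr : p = 2 * (1 - r)) : 1 - 2 * r = p - 1 := by linarith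

/-- Criticality, 1 - 2r = p - 1, turns iβ_i into 1 plus an increasing function of i ln(n/i). -/
lemma mul_beta_eq (hpr : p = 2 * (1 - r)) {i : ℕ} (hi : i ∈ idx n) :
    i * beta n r p i = (1 - 2 * r) ^ p * Real.log n / (n : ℝ) ^ (1 - 2 * r)
      * (i * Real.log (n / i)) ^ (p - 1) + 1 := by
  have hi0 := pos_of_mem_idx hi
  have hl := one_le_log_div hi
  rw [beta, mul_add, mul_inv_cancel₀ hi0.ne', Real.mul_rpow hi0.le (by linarith),
    show p - 1 = -2 * r + 1 by linarith, Real.rpow_add_one hi0.ne']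
  ring

lemma beta_pos (hn : 3 ≤ n) (hr : r ≤ 1 / 2) {i : ℕ} (hi : i ∈ idx n) : 0 < beta n r p i := by
  have hi0 := pos_of_mem_idx hi
  have hl := one_le_log_div hi
  have hL := one_le_log hn
  have : 0 ≤ 1 - 2 * r := by linarith
  unfold beta
  positivity

/-- The form from which both monotonicity and the bound by i^{-1/2} are read off, as iβ_i is
non-decreasing, at least 1, and raised to a non-positive power. -/
lemma coefIVa_eq (hn : 3 ≤ n) (hr : r < 1 / 2) (hpr : p = 2 * (1 - r)) {i : ℕ} (hi : i ∈ idx n) :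
    coefIVa n r p i
      = (i * beta n r p i) ^ (-(3 - 2 * p) / (2 * (p - 1))) * (i : ℝ) ^ (-(1 / 2) : ℝ) := by
  have hi0 := pos_of_mem_idx hi
  have hp : p - 1 ≠ 0 := by linarith
  rw [coefIVa, Real.mul_rpow hi0.le (beta_pos hn hr.le hi).le, mul_right_comm,
    ← Real.rpow_add hi0, mul_comm]
  congr 2
  rw [show r = 1 - p / 2 by linarith]
  field_simp
  ring

lemma one_le_mul_beta (hn : 3 ≤ n) (hr : r ≤ 1 / 2) (hpr : p = 2 * (1 - r)) {i : ℕ}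
    (hi : i ∈ idx n) : 1 ≤ i * beta n r p i := by
  rw [mul_beta_eq hpr hi]
  have hi0 := pos_of_mem_idx hi
  have hl := one_le_log_div hi
  have hL := one_le_log hn
  have : 0 ≤ 1 - 2 * r := by linarith
  have : 0 ≤ (1 - 2 * r) ^ p * Real.log n / (n : ℝ) ^ (1 - 2 * r)
      * (i * Real.log (n / i)) ^ (p - 1) := by positivity
  linarith

lemma mul_beta_mono (hn : 3 ≤ n) (hr : r ≤ 1 / 2) (hpr : p = 2 * (1 - r)) {i j : ℕ}
    (hi : i ∈ idx n) (hj : j ∈ idx n) (hij : i ≤ j) :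
    i * beta n r p i ≤ j * beta n r p j := by
  rw [mul_beta_eq hpr hi, mul_beta_eq hpr hj]
  have hi0 := pos_of_mem_idx hi
  have hl := one_le_log_div hi
  have hL := one_le_log hn
  have h0 : 0 ≤ 1 - 2 * r := by linarith
  have h1 : (i * Real.log (n / i)) ^ (p - 1) ≤ (j * Real.log (n / j)) ^ (p - 1) :=
    Real.rpow_le_rpow (by positivity) (mul_log_div_monotone hj (mem_idx.1 hi).1 hij) (by linarith)
  gcongr

lemma exponent_nonpos (hr4 : 1 / 4 < r) (hr : r < 1 / 2) (hpr : p = 2 * (1 - r)) :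
    -(3 - 2 * p) / (2 * (p - 1)) ≤ 0 :=
  div_nonpos_of_nonpos_of_nonneg (by linarith) (by linarith)

lemma coefIVa_pos (hn : 3 ≤ n) (hr : r ≤ 1 / 2) {i : ℕ} (hi : i ∈ idx n) :
    0 < coefIVa n r p i := by
  have hi0 := pos_of_mem_idx hi
  have := beta_pos (p := p) hn hr hi
  unfold coefIVa
  positivity

lemma coefIVa_antitoneOn (hn : 3 ≤ n) (hr4 : 1 / 4 < r) (hr : r < 1 / 2) (hpr : p = 2 * (1 - r)) :
    AntitoneOn (coefIVa n r p) (idx n) := by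
  intro i hi j hj hij
  have hi0 := pos_of_mem_idx hi
  have hj0 := pos_of_mem_idx hj
  have hb := one_le_mul_beta hn hr.le hpr hi
  have hb' := one_le_mul_beta hn hr.le hpr hj
  rw [coefIVa_eq hn hr hpr hi, coefIVa_eq hn hr hpr hj]
  refine mul_le_mul ?_ ?_ (by positivity) (by positivity)
  · exact Real.rpow_le_rpow_of_nonpos (by linarith) (mul_beta_mono hn hr.le hpr hi hj hij)
      (exponent_nonpos hr4 hr hpr)
  · exact Real.rpow_le_rpow_of_nonpos hi0 (by exact_mod_cast hij) (by norm_num)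

lemma coefIVa_le_rpow (hn : 3 ≤ n) (hr4 : 1 / 4 < r) (hr : r < 1 / 2) (hpr : p = 2 * (1 - r))
    {i : ℕ} (hi : i ∈ idx n) : coefIVa n r p i ≤ (i : ℝ) ^ (-(1 / 2) : ℝ) := by
  have hi0 := pos_of_mem_idx hi
  rw [coefIVa_eq hn hr hpr hi]
  exact mul_le_of_le_one_left (by positivity) (Real.rpow_le_one_of_one_le_of_nonpos
    (one_le_mul_beta hn hr.le hpr hi) (exponent_nonpos hr4 hr hpr))

lemma logSum_le_of_critical (hn : 3 ≤ n) (hr4 : 1 / 4 < r) (hr : r < 1 / 2)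
    (hpr : p = 2 * (1 - r)) :
    logSum n r p ≤ 36 * ((1 - 2 * r) ^ p)⁻¹ * (n : ℝ) ^ (1 - 2 * r) := by
  have ha : 0 < 1 - 2 * r := by linarith
  refine (logSum_le_of_pos hn (by linarith) hr (by linarith)).trans ?_
  gcongr
  rw [div_eq_mul_inv, Real.mul_rpow (by linarith) (by positivity), Real.inv_rpow ha.le]
  gcongr
  calc (4 * p) ^ p ≤ (6 : ℝ) ^ p := Real.rpow_le_rpow (by linarith) (by linarith) (by linarith)
    _ ≤ 6 ^ (2 : ℝ) := Real.rpow_le_rpow_of_exponent_le (by norm_num) (by linarith)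
    _ = 36 := by norm_num

/-- The prefactor of the profile in β is chosen so that its sum is of order ln n, like the harmonic
part: 38 = 36 + 2. -/
lemma sum_beta_le (hn : 3 ≤ n) (hr4 : 1 / 4 < r) (hr : r < 1 / 2) (hpr : p = 2 * (1 - r)) :
    ∑ i ∈ idx n, beta n r p i ≤ 38 * Real.log n := by
  have hL := one_le_log hn
  have ha : 0 < 1 - 2 * r := by linarith
  have hn0 : (0 : ℝ) < n := by positivity
  have h1 : ∑ i ∈ idx n, beta n r p i
      ≤ (1 - 2 * r) ^ p * Real.log n / (n : ℝ) ^ (1 - 2 * r) * logSum n r p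
        + ∑ i ∈ Finset.Icc 1 n, (i : ℝ)⁻¹ := by
    rw [logSum, Finset.mul_sum, ← Finset.sum_add_distrib]
    have hlog : ∀ i ∈ Finset.Icc 1 n, 1 ≤ 1 + Real.log ((n : ℝ) / i) := fun i hi => by
      rw [Finset.mem_Icc] at hi
      exact one_le_one_add_log_div hi.1 hi.2
    refine (Finset.sum_le_sum fun i hi => ?_).trans
      (Finset.sum_le_sum_of_subset_of_nonneg (idx_subset n) fun i hi _ => ?_)
    · have := one_le_log_div hi
      rw [beta, mul_assoc]
      have h2 : Real.log ((n : ℝ) / i) ^ (p - 1) ≤ (1 + Real.log (n / i)) ^ (p - 1) :=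
        Real.rpow_le_rpow (by linarith) (by linarith) (by linarith)
      gcongr
    · have := hlog i hi
      positivity
  have h2 : (1 - 2 * r) ^ p * Real.log n / (n : ℝ) ^ (1 - 2 * r) * logSum n r p
      ≤ 36 * Real.log n := by
    calc _ ≤ (1 - 2 * r) ^ p * Real.log n / (n : ℝ) ^ (1 - 2 * r)
          * (36 * ((1 - 2 * r) ^ p)⁻¹ * (n : ℝ) ^ (1 - 2 * r)) := by
          gcongr
          exact logSum_le_of_critical hn hr4 hr hpr
      _ = _ := by
          have h3 : (1 - 2 * r) ^ p ≠ 0 := by positivity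
          have h4 : (n : ℝ) ^ (1 - 2 * r) ≠ 0 := by positivity
          field_simp
  linarith [sum_inv_le n]

lemma normIVa_nonneg (hn : 3 ≤ n) (hr : r ≤ 1 / 2) (x : E n) : 0 ≤ normIVa r p x :=
  Finset.sum_nonneg fun i hi => mul_nonneg (coefIVa_pos hn hr hi).le (ord_nonneg x i)

lemma lorentzSum_le_normIVa (hn : 3 ≤ n) (hr4 : 1 / 4 < r) (hr : r < 1 / 2) (hpr : p = 2 * (1 - r))
    (x : E n) :
    lorentzSum r p x
      ≤ 228 * Real.log n ^ (3 - 2 * p) * normIVa r p x ^ (2 * (p - 1)) := by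
  have hL := one_le_log hn
  have hN := normIVa_nonneg (p := p) hn hr.le x
  refine (lorentzSum_le_of_factor hn (by linarith) (by linarith) (by linarith)
    (a := coefIVa n r p) (b := beta n r p) (fun i hi => (coefIVa_pos hn hr.le hi).le)
    (fun i hi => (beta_pos hn hr.le hi).le) (fun i hi => ?_) x).trans ?_
  · have hi0 := pos_of_mem_idx hi
    have hb := beta_pos (p := p) hn hr.le hi
    have hp : p - 1 ≠ 0 := by linarith
    rw [coefIVa, Real.mul_rpow (by positivity) (by positivity), ← Real.rpow_mul hb.le,
      ← Real.rpow_mul hi0.le, mul_right_comm, ← Real.rpow_add hb,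
      div_mul_cancel₀ _ (by positivity), neg_add_cancel, Real.rpow_zero, one_mul]
    congr 1
    field_simp
  · change 6 * ((∑ i ∈ idx n, beta n r p i) ^ (3 - 2 * p) * normIVa r p x ^ (2 * (p - 1))) ≤ _
    have h1 : (∑ i ∈ idx n, beta n r p i) ^ (3 - 2 * p) ≤ 38 * Real.log n ^ (3 - 2 * p) := by
      calc (∑ i ∈ idx n, beta n r p i) ^ (3 - 2 * p) ≤ (38 * Real.log n) ^ (3 - 2 * p) :=
            Real.rpow_le_rpow (Finset.sum_nonneg fun i hi => (beta_pos hn hr.le hi).le)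
              (sum_beta_le hn hr4 hr hpr) (by linarith)
        _ ≤ _ := by
            rw [Real.mul_rpow (by norm_num) (by linarith)]
            have : (38 : ℝ) ^ (3 - 2 * p) ≤ 38 :=
              rpow_le_self_of_one_le (by norm_num) (by linarith)
            gcongr
    calc _ ≤ 6 * (38 * Real.log n ^ (3 - 2 * p) * normIVa r p x ^ (2 * (p - 1))) := by gcongr
      _ = _ := by ring

/-- Dropping the summand 1 from iβ_i gives a second coefficient bound, suited to the logarithmic
profile; the bound by i^{-1/2} is kept for the excess. -/
lemma coefIVa_mul_sqrt_log_le (hn : 3 ≤ n) (hr4 : 1 / 4 < r) (hr : r < 1 / 2)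
    (hpr : p = 2 * (1 - r)) {i : ℕ} (hi : i ∈ idx n) :
    coefIVa n r p i * Real.log (n / i) ^ (1 / 2 : ℝ)
      ≤ ((1 - 2 * r) ^ p * Real.log n / (n : ℝ) ^ (1 - 2 * r)) ^ (-(3 - 2 * p) / (2 * (p - 1)))
        * ((i : ℝ) ^ (-2 * r) * Real.log (n / i) ^ (p - 1)) := by
  have hi0 := pos_of_mem_idx hi
  have hl := one_le_log_div hi
  have hl0 : 0 < Real.log ((n : ℝ) / i) := by linarith
  have hL := one_le_log hn
  have ha : 0 < 1 - 2 * r := by linarith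
  have hn0 : (0 : ℝ) < n := by positivity
  have hp : p - 1 ≠ 0 := by linarith
  obtain ⟨A, hA⟩ : ∃ A, A = (1 - 2 * r) ^ p * Real.log n / (n : ℝ) ^ (1 - 2 * r) := ⟨_, rfl⟩
  have hA0 : 0 < A := by rw [hA]; positivity
  rw [coefIVa_eq hn hr hpr hi, mul_beta_eq hpr hi, ← hA]
  have h1 : (A * (i * Real.log (n / i)) ^ (p - 1) + 1) ^ (-(3 - 2 * p) / (2 * (p - 1)))
      ≤ (A * (i * Real.log (n / i)) ^ (p - 1)) ^ (-(3 - 2 * p) / (2 * (p - 1))) :=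
    Real.rpow_le_rpow_of_nonpos (by positivity) (by linarith) (exponent_nonpos hr4 hr hpr)
  calc _ ≤ (A * (i * Real.log (n / i)) ^ (p - 1)) ^ (-(3 - 2 * p) / (2 * (p - 1)))
        * (i : ℝ) ^ (-(1 / 2) : ℝ) * Real.log (n / i) ^ (1 / 2 : ℝ) := by gcongr
    _ = A ^ (-(3 - 2 * p) / (2 * (p - 1)))
        * (((i : ℝ) ^ (p - 3 / 2) * (i : ℝ) ^ (-(1 / 2) : ℝ))
          * (Real.log (n / i) ^ (p - 3 / 2) * Real.log (n / i) ^ (1 / 2 : ℝ))) := by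
        rw [Real.mul_rpow hA0.le (by positivity), ← Real.rpow_mul (by positivity),
          show (p - 1) * (-(3 - 2 * p) / (2 * (p - 1))) = p - 3 / 2 by field_simp; ring,
          Real.mul_rpow hi0.le hl0.le]
        ring
    _ = _ := by
        rw [← Real.rpow_add hi0, ← Real.rpow_add hl0, show p - 3 / 2 + -(1 / 2) = -2 * r by linarith,
          show p - 3 / 2 + 1 / 2 = p - 1 by ring]

lemma normIVa_le_of_mem_goodSet (hn : 3 ≤ n) (hr4 : 1 / 4 < r) (hr : r < 1 / 2)
    (hpr : p = 2 * (1 - r)) {t : ℝ} (ht : 0 < t) {x : E n} (hx : x ∈ goodSet n t) :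
    normIVa r p x ≤ levelIVa 288 n r p t := by
  have hL := one_le_log hn
  have ha : 0 < 1 - 2 * r := by linarith
  have hn0 : (0 : ℝ) < n := by positivity
  have hp : p - 1 ≠ 0 := by linarith
  obtain ⟨A, hA⟩ : ∃ A, A = (1 - 2 * r) ^ p * Real.log n / (n : ℝ) ^ (1 - 2 * r) := ⟨_, rfl⟩
  have hA0 : 0 < A := by rw [hA]; positivity
  obtain ⟨s, hs⟩ : ∃ s, s = -(3 - 2 * p) / (2 * (p - 1)) := ⟨_, rfl⟩
  have h1 : normIVa r p x ≤ 8 * (A ^ s * logSum n r p)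
      + ∑ i ∈ Finset.Icc 1 n, (i : ℝ) ^ (-(1 / 2) : ℝ) * excess x i ^ (1 / 2 : ℝ) := by
    rw [logSum, Finset.mul_sum, Finset.mul_sum, ← Finset.sum_add_distrib, normIVa]
    refine (Finset.sum_le_sum fun i hi => ?_).trans
      (Finset.sum_le_sum_of_subset_of_nonneg (idx_subset n) fun i hi _ => ?_)
    · have hmem := Finset.mem_Icc.1 (idx_subset n hi)
      have hl := one_le_log_div hi
      have hc := coefIVa_pos (p := p) hn hr.le hi
      have hw := excess_nonneg x i
      have h2 : (1 + Real.log ((n : ℝ) / i)) ^ (1 / 2 : ℝ) ≤ 2 * Real.log (n / i) ^ (1 / 2 : ℝ) := by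
        rw [← Real.sqrt_eq_rpow, ← Real.sqrt_eq_rpow]
        refine Real.sqrt_le_iff.2 ⟨by positivity, ?_⟩
        rw [mul_pow, Real.sq_sqrt (by linarith)]
        linarith
      have h3 := coefIVa_mul_sqrt_log_le hn hr4 hr hpr hi
      rw [← hA, ← hs] at h3
      have h4 : Real.log ((n : ℝ) / i) ^ (p - 1) ≤ (1 + Real.log (n / i)) ^ (p - 1) :=
        Real.rpow_le_rpow (by linarith) (by linarith) (by linarith)
      calc coefIVa n r p i * ord x i
          ≤ coefIVa n r p i * (4 * (2 * Real.log (n / i) ^ (1 / 2 : ℝ))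
            + excess x i ^ (1 / 2 : ℝ)) := by
            gcongr
            refine (ord_le_add_sqrt_excess x hmem.1 hmem.2).trans ?_
            gcongr
        _ = 8 * (coefIVa n r p i * Real.log (n / i) ^ (1 / 2 : ℝ))
            + coefIVa n r p i * excess x i ^ (1 / 2 : ℝ) := by ring
        _ ≤ 8 * (A ^ s * ((i : ℝ) ^ (-2 * r) * Real.log (n / i) ^ (p - 1)))
            + (i : ℝ) ^ (-(1 / 2) : ℝ) * excess x i ^ (1 / 2 : ℝ) := by
            have := coefIVa_le_rpow hn hr4 hr hpr hi
            gcongr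
        _ ≤ _ := by gcongr
    · rw [Finset.mem_Icc] at hi
      have := one_le_one_add_log_div hi.1 hi.2
      have := excess_nonneg x i
      positivity
  have h2 : A ^ s * logSum n r p ≤ 36 * ((1 - 2 * r) ^ (-p / (2 * (p - 1)))
      * Real.log n ^ s * (n : ℝ) ^ (1 / 2 : ℝ)) := by
    calc A ^ s * logSum n r p
        ≤ A ^ s * (36 * ((1 - 2 * r) ^ p)⁻¹ * (n : ℝ) ^ (1 - 2 * r)) := by
          gcongr
          exact logSum_le_of_critical hn hr4 hr hpr
      _ = 36 * (((1 - 2 * r) ^ (p * s) * (1 - 2 * r) ^ (-p)) * Real.log n ^ s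
          * ((n : ℝ) ^ (-((1 - 2 * r) * s)) * (n : ℝ) ^ (1 - 2 * r))) := by
          rw [hA, Real.div_rpow (by positivity) (by positivity),
            Real.mul_rpow (by positivity) (by positivity), ← Real.rpow_mul ha.le,
            ← Real.rpow_mul hn0.le, Real.rpow_neg ha.le, Real.rpow_neg hn0.le, div_eq_mul_inv]
          ring
      _ = _ := by
          rw [← Real.rpow_add ha, ← Real.rpow_add hn0]
          have e1 : p * s + -p = -p / (2 * (p - 1)) := by
            rw [hs]
            field_simp
            ring
          have e2 : -((1 - 2 * r) * s) + (1 - 2 * r) = 1 / 2 := by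
            rw [hs, one_sub_two_mul_eq hpr]
            field_simp
            ring
          rw [e1, e2]
  -- With weights i^{-1/2} Cauchy–Schwarz meets only the harmonic sum, whence (ln n)^{1/2} t.
  have h3 := sum_mul_sqrt_excess_le ht hx (c := -(1 / 2)) (M := 4 * Real.log n) (by
    have : ∀ i : ℕ, (i : ℝ) ^ (2 * -(1 / 2) : ℝ) = (i : ℝ)⁻¹ := fun i => by
      rw [show (2 * -(1 / 2) : ℝ) = -1 by norm_num, Real.rpow_neg_one]
    simp only [this]
    linarith [sum_inv_le n])
  have h4 : (4 * Real.log n) ^ (1 / 2 : ℝ) = 2 * Real.log n ^ (1 / 2 : ℝ) := by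
    rw [Real.mul_rpow (by norm_num) (by linarith), ← Real.sqrt_eq_rpow 4,
      show (4 : ℝ) = 2 ^ 2 by norm_num, Real.sqrt_sq (by norm_num)]
  rw [h4] at h3
  -- 288 = 8 · 36 suffices by itself; since 1/(p-1) ≥ 1 it may be raised to the form in which the
  -- level is stated.
  have h5 : (288 : ℝ) ≤ 288 ^ (1 / (p - 1)) :=
    Real.self_le_rpow_of_one_le (by norm_num) (by
      rw [le_div_iff₀ (by linarith)]
      linarith)
  unfold levelIVa
  rw [← hs]
  calc normIVa r p x ≤ 288 * ((1 - 2 * r) ^ (-p / (2 * (p - 1)))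
        * Real.log n ^ s * (n : ℝ) ^ (1 / 2 : ℝ)) + 288 * (Real.log n ^ (1 / 2 : ℝ) * t) := by
        have : 0 ≤ Real.log n ^ (1 / 2 : ℝ) * t := by positivity
        linarith
    _ ≤ 288 ^ (1 / (p - 1)) * ((1 - 2 * r) ^ (-p / (2 * (p - 1)))
        * Real.log n ^ s * (n : ℝ) ^ (1 / 2 : ℝ))
        + 288 ^ (1 / (p - 1)) * (Real.log n ^ (1 / 2 : ℝ) * t) := by
        gcongr
    _ = _ := by ring

/-- Raising to 2(p-1) turns 288^{1/(p-1)} into 288². With a = 1-2r, p = 1 + a and (1/a)^a ≤ e, so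
a^{-p} ≤ e/a. -/
lemma levelIVa_rpow_le (hn : 3 ≤ n) (hr4 : 1 / 4 < r) (hr : r < 1 / 2)
    (hpr : p = 2 * (1 - r)) {t : ℝ} (ht : 0 < t) :
    228 * Real.log n ^ (3 - 2 * p) * levelIVa 288 n r p t ^ (2 * (p - 1))
      ≤ (228 * 288 ^ 2 * Real.exp 1) * (1 - 2 * r)⁻¹ * (n : ℝ) ^ (1 - 2 * r)
        + (228 * 288 ^ 2 * Real.exp 1) * Real.log n ^ (2 - p) * t ^ (2 * (p - 1)) := by
  have hL := one_le_log hn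
  have hL0 : 0 < Real.log n := by linarith
  have ha : 0 < 1 - 2 * r := by linarith
  have hn0 : (0 : ℝ) < n := by positivity
  have hp : p - 1 ≠ 0 := by linarith
  have hS : levelIVa 288 n r p t ^ (2 * (p - 1)) ≤ 288 ^ 2 * ((1 - 2 * r) ^ (-p)
      * Real.log n ^ (-(3 - 2 * p)) * (n : ℝ) ^ (1 - 2 * r)
      + Real.log n ^ (p - 1) * t ^ (2 * (p - 1))) := by
    unfold levelIVa
    refine (Real.rpow_add_le_add_rpow (by positivity) (by positivity) (by linarith)
      (by linarith)).trans_eq ?_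
    rw [Real.mul_rpow (by positivity) (by positivity), Real.mul_rpow (by positivity) (by positivity),
      Real.mul_rpow (by positivity) (by positivity), Real.mul_rpow (by positivity) ht.le,
      Real.mul_rpow (by positivity) (by positivity), ← Real.rpow_mul (by norm_num),
      ← Real.rpow_mul ha.le, ← Real.rpow_mul hL0.le, ← Real.rpow_mul hL0.le, ← Real.rpow_mul hn0.le,
      show 1 / (p - 1) * (2 * (p - 1)) = 2 by field_simp, div_mul_cancel₀ _ (by simpa using hp),
      div_mul_cancel₀ _ (by simpa using hp), show 1 / 2 * (2 * (p - 1)) = p - 1 by ring,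
      Real.rpow_two, one_sub_two_mul_eq hpr]
    ring
  have he : (1 - 2 * r) ^ (-p) ≤ Real.exp 1 * (1 - 2 * r)⁻¹ := by
    rw [show -p = -(1 - 2 * r) + -1 by linarith, Real.rpow_add ha, Real.rpow_neg_one]
    gcongr
    rw [Real.rpow_neg ha.le, ← Real.inv_rpow ha.le]
    refine (rpow_le_exp (by positivity) ha.le).trans_eq ?_
    rw [inv_mul_cancel₀ ha.ne']
  calc 228 * Real.log n ^ (3 - 2 * p) * levelIVa 288 n r p t ^ (2 * (p - 1))
      ≤ 228 * Real.log n ^ (3 - 2 * p) * (288 ^ 2 * ((1 - 2 * r) ^ (-p)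
        * Real.log n ^ (-(3 - 2 * p)) * (n : ℝ) ^ (1 - 2 * r)
        + Real.log n ^ (p - 1) * t ^ (2 * (p - 1)))) := by gcongr
    _ = 228 * 288 ^ 2 * (1 - 2 * r) ^ (-p) * (Real.log n ^ (3 - 2 * p)
          * Real.log n ^ (-(3 - 2 * p))) * (n : ℝ) ^ (1 - 2 * r)
        + 228 * 288 ^ 2 * 1 * (Real.log n ^ (3 - 2 * p) * Real.log n ^ (p - 1))
          * t ^ (2 * (p - 1)) := by ring
    _ ≤ 228 * 288 ^ 2 * (Real.exp 1 * (1 - 2 * r)⁻¹) * (Real.log n ^ (3 - 2 * p)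
          * Real.log n ^ (-(3 - 2 * p))) * (n : ℝ) ^ (1 - 2 * r)
        + 228 * 288 ^ 2 * Real.exp 1 * (Real.log n ^ (3 - 2 * p) * Real.log n ^ (p - 1))
          * t ^ (2 * (p - 1)) := by
        have : 1 ≤ Real.exp 1 := Real.one_le_exp (by norm_num)
        gcongr
    _ = _ := by
        rw [← Real.rpow_add hL0, ← Real.rpow_add hL0, add_neg_cancel, Real.rpow_zero,
          show 3 - 2 * p + (p - 1) = 2 - p by ring]
        ring

end

theorem caseIVa : ∃ C C₁ C₂ C₃ : ℝ, 0 < C ∧ 0 < C₁ ∧ 0 < C₂ ∧ 0 < C₃ ∧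
      ∀ (n : ℕ) (r p t : ℝ), 3 ≤ n → 1 / 4 < r → r ≤ 1 / 2 → p = 2 * (1 - r) → 0 < t →
        Real.exp 1 ≤ (1 - 2 * r) * Real.log n →
        ∀ R S : ℝ, S = levelIVa C₂ n r p t →
          R = C₁ * Real.log n ^ (3 - 2 * p) * S ^ (2 * (p - 1)) →
          1 < p ∧ p < 3 / 2 ∧
          AntitoneOn (coefIVa n r p) {i : ℕ | 1 ≤ i ∧ (i : ℝ) ≤ n / Real.exp 1} ∧
          IsNorm (normIVa (n := n) r p) ∧
          (∀ x : E n, lorentzSum r p x ≤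
            C₁ * Real.log n ^ (3 - 2 * p) * normIVa r p x ^ (2 * (p - 1))) ∧
          R ≤ C₃ * (1 - 2 * r)⁻¹ * (n : ℝ) ^ (1 - 2 * r)
            + C₃ * Real.log n ^ (2 - p) * t ^ (2 * (p - 1)) ∧
          GaussianBound.{u} C t (normIVa (n := n) r p) S ∧
          ∀ x : E n, normIVa r p x ≤ S → lorentzSum r p x ≤ R := by
  refine ⟨4, 228, 288, 228 * 288 ^ 2 * Real.exp 1, by norm_num, by norm_num, by norm_num,
    by positivity, ?_⟩
  intro n r p t hn hr4 hr2 hpr ht hlarge R S hS hR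
  have hL := one_le_log hn
  have hr : r < 1 / 2 := by
    have := Real.exp_pos 1
    by_contra hcon
    rw [show r = 1 / 2 by linarith] at hlarge
    norm_num at hlarge
    linarith
  have hanti := coefIVa_antitoneOn hn hr4 hr hpr
  refine ⟨by linarith, by linarith, ?_, ?_, lorentzSum_le_normIVa hn hr4 hr hpr, ?_, ?_, ?_⟩
  · exact hanti.mono fun i hi => mem_idx.2 hi
  · exact isNorm_sum_idx hn hanti fun i hi => coefIVa_pos hn hr2 hi
  · rw [hR, hS]
    exact levelIVa_rpow_le hn hr4 hr hpr ht
  · refine gaussianBound_of_goodSet (by omega) fun x hx => ?_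
    rw [hS]
    exact normIVa_le_of_mem_goodSet hn hr4 hr hpr ht hx
  · intro x hx
    refine (lorentzSum_le_normIVa hn hr4 hr hpr x).trans ?_
    rw [hR]
    have := normIVa_nonneg (p := p) hn hr2 x
    have : 0 ≤ 2 * (p - 1) := by linarith
    gcongr

end Lorentz

/-! ### Assembly of the cases -/

theorem theorem1 :
    -- Case I
    (∃ C C₁ : ℝ, 0 < C ∧ 0 < C₁ ∧
      ∀ (n : ℕ) (r p t : ℝ), 3 ≤ n → 0 ≤ r → 3 / 2 ≤ p → 0 < t →
        ∀ R S : ℝ, R = Lorentz.levelI C₁ n r p t → S = R ^ (1 / (2 * (p - 1))) →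
          S ^ (2 * (p - 1)) = R ∧
          Lorentz.IsNorm (Lorentz.normI (n := n) r p) ∧
          Lorentz.GaussianBound.{u} C t (Lorentz.normI (n := n) r p) S ∧
          ∀ x : Lorentz.E n, Lorentz.normI r p x ≤ S → Lorentz.lorentzSum r p x ≤ R) ∧
    -- Case II
    (∃ C C₁ C₂ C₃ C₄ : ℝ, 0 < C ∧ 0 < C₁ ∧ 0 < C₂ ∧ 0 < C₃ ∧ 0 < C₄ ∧
      ∀ (n : ℕ) (r p t : ℝ), 3 ≤ n → 0 ≤ r → 1 ≤ p → p < 3 / 2 → 0 < t →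
        ∀ R S : ℝ, S = C₂ * Lorentz.sumII n r p t → R = C₃ * Lorentz.sumII n r p t →
          (3 / 2 - 2 * r ≤ p → Lorentz.IsNorm (Lorentz.normII (n := n) r p t)) ∧
          (∀ x : Lorentz.E n, Lorentz.lorentzSum r p x ≤
            C₁ * Lorentz.sumII n r p t ^ (3 - 2 * p)
              * Lorentz.normII r p t x ^ (2 * (p - 1))) ∧
          S ≤ Lorentz.boundII C₄ n r p t ∧
          R ≤ Lorentz.boundII C₄ n r p t ∧
          Lorentz.GaussianBound.{u} C t (Lorentz.normII (n := n) r p t) S ∧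
          ∀ x : Lorentz.E n, Lorentz.normII r p t x ≤ S → Lorentz.lorentzSum r p x ≤ R) ∧
    -- Case III
    (∃ C C₁ C₂ C₃ : ℝ, 0 < C ∧ 0 < C₁ ∧ 0 < C₂ ∧ 0 < C₃ ∧
      ∀ (n : ℕ) (r p t : ℝ), 3 ≤ n → 0 ≤ r → 1 ≤ p → p < 3 / 2 - 2 * r → 0 < t →
        ∀ R S : ℝ, S = Lorentz.levelIII C₂ n r t →
          R = C₁ * (n : ℝ) ^ ((1 - 2 * r) * (3 - 2 * p)) * S ^ (2 * (p - 1)) →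
          r < 1 / 4 ∧ p < 3 / 2 ∧
          Lorentz.IsNorm (Lorentz.normIII (n := n) r) ∧
          (∀ x : Lorentz.E n, Lorentz.lorentzSum r p x ≤
            C₁ * (n : ℝ) ^ ((1 - 2 * r) * (3 - 2 * p))
              * Lorentz.normIII r x ^ (2 * (p - 1))) ∧
          R ≤ Lorentz.boundIII C₃ n r p t ∧
          Lorentz.GaussianBound.{u} C t (Lorentz.normIII (n := n) r) S ∧
          ∀ x : Lorentz.E n, Lorentz.normIII r x ≤ S → Lorentz.lorentzSum r p x ≤ R) ∧
    -- Case IVa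
    (∃ C C₁ C₂ C₃ : ℝ, 0 < C ∧ 0 < C₁ ∧ 0 < C₂ ∧ 0 < C₃ ∧
      ∀ (n : ℕ) (r p t : ℝ), 3 ≤ n → 1 / 4 < r → r ≤ 1 / 2 → p = 2 * (1 - r) → 0 < t →
        Real.exp 1 ≤ (1 - 2 * r) * Real.log n →
        ∀ R S : ℝ, S = Lorentz.levelIVa C₂ n r p t →
          R = C₁ * Real.log n ^ (3 - 2 * p) * S ^ (2 * (p - 1)) →
          1 < p ∧ p < 3 / 2 ∧
          AntitoneOn (Lorentz.coefIVa n r p) {i : ℕ | 1 ≤ i ∧ (i : ℝ) ≤ n / Real.exp 1} ∧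
          Lorentz.IsNorm (Lorentz.normIVa (n := n) r p) ∧
          (∀ x : Lorentz.E n, Lorentz.lorentzSum r p x ≤
            C₁ * Real.log n ^ (3 - 2 * p) * Lorentz.normIVa r p x ^ (2 * (p - 1))) ∧
          R ≤ C₃ * (1 - 2 * r)⁻¹ * (n : ℝ) ^ (1 - 2 * r)
            + C₃ * Real.log n ^ (2 - p) * t ^ (2 * (p - 1)) ∧
          Lorentz.GaussianBound.{u} C t (Lorentz.normIVa (n := n) r p) S ∧
          ∀ x : Lorentz.E n, Lorentz.normIVa r p x ≤ S → Lorentz.lorentzSum r p x ≤ R) ∧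
    -- Case IVb
    (∃ C C₁ C₂ C₃ : ℝ, 0 < C ∧ 0 < C₁ ∧ 0 < C₂ ∧ 0 < C₃ ∧
      ∀ (n : ℕ) (r p t : ℝ), 3 ≤ n → 1 / 4 < r → r ≤ 1 / 2 → p = 2 * (1 - r) → 0 < t →
        (1 - 2 * r) * Real.log n < Real.exp 1 →
        ∀ R S : ℝ, S = C₂ * (n : ℝ) ^ (1 / 2 : ℝ) + t →
          R = C₁ * Real.log n * S ^ (2 * (p - 1)) →
          1 ≤ p ∧ p < 3 / 2 ∧
          Lorentz.IsNorm (fun x : Lorentz.E n => ‖x‖) ∧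
          (∀ x : Lorentz.E n, Lorentz.lorentzSum r p x ≤
            C₁ * Real.log n * ‖x‖ ^ (2 * (p - 1))) ∧
          R ≤ C₃ * Real.log n * max 1 t ^ (2 * (p - 1)) ∧
          Lorentz.GaussianBound.{u} C t (fun x : Lorentz.E n => ‖x‖) S ∧
          ∀ x : Lorentz.E n, ‖x‖ ≤ S → Lorentz.lorentzSum r p x ≤ R) :=
  ⟨Lorentz.caseI, Lorentz.caseII, Lorentz.caseIII, Lorentz.caseIVa, Lorentz.caseIVb⟩
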